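/- **Setting.** A numeration system is an increasing sequence $U=(U_i)_{i\ge 0}$ of integers with $U_0=1$ and $\sup_i\lceil U_{i+1}/U_i\rceil<\infty$; $\mathrm{rep}_U(n)$ denotes the greedy representation of $n\in\mathbb N$ (most significant digit first, $\mathrm{rep}_U(0)=\varepsilon$). The system is linear if there are $k\ge 1$, $N\ge 0$ and $a_0,\dots,a_{k-1}\in\mathbb Z$, $a_0\ne 0$, with $U_{i+k}=a_{k-1}U_{i+k-1}+\cdots+a_0U_i$ for all $i\ge N$; $k$ is taken minimal. Consider the assumptions * (H1) $\mathrm{rep}_U(\mathbb N)$ is a regular language; * (H2) $\limsup_i (U_{i+1}-U_i)=+\infty$; * (H3) there is $G$ with $U_{i+1}-U_i\le U_{i+2}-U_{i+1}$ for all $i\ge G$. Let $C>0$ be such that for every greedy representation $w$ some word $10^{\ell}w$ with $\ell<C$ is a greedy representation, let $R\ge G$ be least with $U_{R+1}-U_R\ge U_{i+1}-U_i$ for all $i\le R$, and put $Z=\max\{R,C\}$. Let $p_1,\dots,p_t$ be the primes dividing all of $a_0,\dots,a_{k-1}$. For an ultimately periodic set $X\subseteq\mathbb N$ with minimal period $\pi_X$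 write $\pi_X=Q_X\,p_1^{\mu_{X,1}}\cdots p_t^{\mu_{X,t}}$ where no $p_j$ divides $Q_X$. Let $r_X$ be the least $r\in\{0,\dots,Q_X-1\}$ such that $X\cap(Q_X\mathbb N+r)$ has minimal period of the form $Q_X\,p_1^{\nu_1}\cdots p_t^{\nu_t}$ with $\max_j\nu_j=\max_j\mu_{X,j}$, and let $\rho_X=Q_X\,p_1^{\nu_{X,1}}\cdots p_t^{\nu_{X,t}}$ be the minimal period of $X\cap(Q_X\mathbb N+r_X)$. Let $M_{\mu,X}$ be the least $m$ such that $p_j^{\nu_{X,j}}\mid U_i$ for all $i\ge m$ and all $j$, and set $n_X=M_{\mu,X}-1-|\mathrm{rep}_U(\rho_X-1)|\in\mathbb Z$. **Theorem.** Let $U$ be a linear numeration system satisfying (H1), (H2) and (H3), such that the gcd of $a_0,\dots,a_{k-1}$ is larger than $1$. Suppose that for every $B\ge 1$ there is a positive integer $D(B)$, computable from $B$ and the description of $U$, such that every ultimately periodic set $X$ with $Q_X\le B$ and $\max_j\mu_{X,j}\ge D(B)$ satisfies $n_X\ge Z$. Then, given a DFA accepting a language contained in $\mathrm{rep}_U(\mathbb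 N)$, it is decidable whether the set $X=\{n:\mathrm{rep}_U(n)\text{ is accepted}\}$ is ultimately periodic. The decision is uniform in $U$: for every partial computable function $D$ there is one algorithm that takes as input a description of $U$ (the coefficients $a_0,\dots,a_{k-1}$, the first $N+k$ terms, a constant $G$ for (H3), and a DFA accepting $\mathrm{rep}_U(\mathbb N)$) and a DFA, and that halts with the correct answer whenever the assumptions above hold for $U$ and $D$ and the language of the input DFA is contained in $\mathrm{rep}_U(\mathbb N)$. -/

import Mathlib

/-! ### Numeration systems and greedy representations

Words are lists of natural-number digits, most significant digit first. -/

/-- A numeration system: an increasing integer sequence with `U 0 = 1` whose consecutive quotients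
are bounded, i.e. `sup_i ⌈U (i+1) / U i⌉` is finite. -/
structure IsNumerationSystem (U : ℕ → ℕ) : Prop where
  strictMono : StrictMono U
  zero : U 0 = 1
  bdd : BddAbove (Set.range fun i => ⌈(U (i + 1) : ℚ) / (U i : ℚ)⌉)

/-- The numerical value of a word. -/
def val (U : ℕ → ℕ) : List ℕ → ℕ
  | [] => 0
  | d :: w => d * U w.length + val U w

/-- The greedy digits of `n` at the positions `l - 1, …, 0`. -/
def greedyDigits (U : ℕ → ℕ) : ℕ → ℕ → List ℕ
  | 0, _ => []
  | l + 1, n => (n / U l) :: greedyDigits U l (n % U l)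

/-- The greedy representation `rep_U(n)`; it is empty for `n = 0`. -/
noncomputable def rep (U : ℕ → ℕ) (n : ℕ) : List ℕ :=
  greedyDigits U (sInf {l | n < U l}) n

/-- The language `rep_U(X)`. -/
def repLang (U : ℕ → ℕ) (X : Set ℕ) : Language ℕ := rep U '' X

theorem greedyDigits_length (U : ℕ → ℕ) (l n : ℕ) : (greedyDigits U l n).length = l := by
  induction l generalizing n with
  | zero => rfl
  | succ l ih => simp [greedyDigits, ih]

theorem val_greedyDigits {U : ℕ → ℕ} (hU : IsNumerationSystem U) (l n : ℕ) (h : n < U l) :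
    val U (greedyDigits U l n) = n := by
  induction l generalizing n with
  | zero => have := hU.zero; simp [greedyDigits, val]; omega
  | succ l ih =>
    have hp : 0 < U l := by
      have := hU.strictMono.monotone (Nat.zero_le l); have := hU.zero; omega
    simp only [greedyDigits, val, greedyDigits_length]
    rw [ih _ (Nat.mod_lt _ hp)]
    exact Nat.div_add_mod' n (U l)

theorem eq_greedyDigits {U : ℕ → ℕ} (w : List ℕ)
    (h : ∀ v, v <:+ w → val U v < U v.length) : w = greedyDigits U w.length (val U w) := by
  induction w with
  | nil => rfl
  | cons d w ih =>
    have hw := h w (List.suffix_cons d w)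
    have hp : 0 < U w.length := by omega
    simp only [List.length_cons, greedyDigits, val]
    have h1 : (d * U w.length + val U w) / U w.length = d := by
      rw [Nat.add_comm, Nat.add_mul_div_right _ _ hp, Nat.div_eq_of_lt hw]; simp
    have h2 : (d * U w.length + val U w) % U w.length = val U w := by
      rw [Nat.add_comm, Nat.add_mul_mod_self_right, Nat.mod_eq_of_lt hw]
    rw [h1, h2, ← ih (fun v hv => h v (hv.trans (List.suffix_cons d w)))]

theorem greedyDigits_suffix {U : ℕ → ℕ} (hU : IsNumerationSystem U) (l n : ℕ) (h : n < U l)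
    (v : List ℕ) (hv : v <:+ greedyDigits U l n) : val U v < U v.length := by
  induction l generalizing n with
  | zero =>
    have := hU.zero
    simp only [greedyDigits, List.suffix_nil] at hv
    subst hv; simp [val]; omega
  | succ l ih =>
    have hp : 0 < U l := by
      have := hU.strictMono.monotone (Nat.zero_le l); have := hU.zero; omega
    rw [greedyDigits, List.suffix_cons_iff] at hv
    rcases hv with rfl | hv
    · have := val_greedyDigits hU (l + 1) n h
      rw [greedyDigits] at this
      rw [this]; simpa [greedyDigits_length] using h
    · exact ih _ (Nat.mod_lt _ hp) hv

/-- `rep U n` is the only word without leading zero whose value is `n` and whose suffixes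
`v` all satisfy the greedy condition `val U v < U |v|`. -/
theorem eq_rep_iff {U : ℕ → ℕ} (hU : IsNumerationSystem U) (n : ℕ) (w : List ℕ) :
    w = rep U n ↔ val U w = n ∧ w.head? ≠ some 0 ∧ ∀ v, v <:+ w → val U v < U v.length := by
  have hne : n < U (sInf {l | n < U l}) :=
    Nat.sInf_mem (s := {l | n < U l}) ⟨n + 1, Nat.lt_of_lt_of_le (Nat.lt_succ_self n)
      (hU.strictMono.le_apply)⟩
  constructor
  · rintro rfl
    refine ⟨val_greedyDigits hU _ _ hne, ?_, fun v hv => greedyDigits_suffix hU _ _ hne v hv⟩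
    unfold rep
    rcases hl : sInf {l | n < U l} with _ | l
    · simp [greedyDigits]
    · have hlt : ¬ n < U l := fun hc => by
        have := Nat.sInf_le (s := {l | n < U l}) hc
        omega
      have hp : 0 < U l := by
        have := hU.strictMono.monotone (Nat.zero_le l); have := hU.zero; omega
      have := Nat.div_pos (not_lt.mp hlt) hp
      simp only [greedyDigits, List.head?_cons, ne_eq, Option.some.injEq]
      omega
  · rintro ⟨rfl, h0, hs⟩
    have hw := hs w (List.suffix_refl w)
    have : sInf {l | val U w < U l} = w.length := by
      refine le_antisymm (Nat.sInf_le hw) ?_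
      cases w with
      | nil => simp
      | cons d w =>
        by_contra hc
        have hle : sInf {l | val U (d :: w) < U l} ≤ w.length := by
          simp only [List.length_cons] at hc; omega
        have h3 := hU.strictMono.monotone hle
        have hd : d ≠ 0 := by simpa using h0
        have h4 : U w.length ≤ d * U w.length := Nat.le_mul_of_pos_left _ (Nat.pos_of_ne_zero hd)
        have h5 : val U (d :: w) = d * U w.length + val U w := rfl
        omega
    rw [rep, this]
    exact eq_greedyDigits w hs

/-! ### Assumptions on the numeration system -/

/-- The gap `U (i+1) - U i` (no truncation, as `U` is increasing). -/
def gap (U : ℕ → ℕ) (i : ℕ) : ℕ := U (i + 1) - U i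

/-- (H1): the set of all natural numbers is `U`-recognizable. -/
def H1 (U : ℕ → ℕ) : Prop := (repLang U Set.univ).IsRegular

/-- (H2): the limit superior of the gaps is infinite. -/
def H2 (U : ℕ → ℕ) : Prop := ∀ B m : ℕ, ∃ i ≥ m, B ≤ gap U i

/-- (H3) with the constant `G`: the gaps are non-decreasing from the index `G` on. -/
def H3 (U : ℕ → ℕ) (G : ℕ) : Prop := ∀ i ≥ G, gap U i ≤ gap U (i + 1)

/-- `C > 0`, and every greedy representation `w` has some `l < C` for which `1 0^l w` is a greedy
representation. -/
def IsInsertionBound (U : ℕ → ℕ) (C : ℕ) : Prop :=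
  0 < C ∧ ∀ w ∈ repLang U Set.univ, ∃ l < C,
    1 :: (List.replicate l 0 ++ w) ∈ repLang U Set.univ

/-- `Z = max R C`, where `R ≥ G` is least such that the gap at `R` dominates all earlier gaps. -/
noncomputable def constZ (U : ℕ → ℕ) (G C : ℕ) : ℕ :=
  max (sInf {R | G ≤ R ∧ ∀ i ≤ R, gap U i ≤ gap U R}) C

/-- For all `i ≥ N`, `U (i+k) = a_{k-1} U (i+k-1) + ⋯ + a_0 U i`, where `a = [a_0, …, a_{k-1}]`,
`k ≥ 1` and `a_0 ≠ 0`. -/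
def SatisfiesRec (U : ℕ → ℕ) (a : List ℤ) (N : ℕ) : Prop :=
  a ≠ [] ∧ a.getD 0 0 ≠ 0 ∧
    ∀ i ≥ N, (U (i + a.length) : ℤ) = ∑ j ∈ Finset.range a.length, a.getD j 0 * (U (i + j) : ℤ)

/-- `a` is the list of coefficients of a recurrence relation of minimal order ultimately
satisfied by `U`, and the relation holds from the index `N` on. -/
def IsMinimalRec (U : ℕ → ℕ) (a : List ℤ) (N : ℕ) : Prop :=
  SatisfiesRec U a N ∧ ∀ (b : List ℤ) (N' : ℕ), SatisfiesRec U b N' → a.length ≤ b.length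

/-- The gcd of the coefficients. -/
def coeffGcd (a : List ℤ) : ℕ := a.foldr (fun c g => Nat.gcd c.natAbs g) 0

/-- The primes `p_1, …, p_t` dividing all the coefficients. -/
def sharedPrimes (a : List ℤ) : Finset ℕ := (coeffGcd a).primeFactors

/-! ### Ultimately periodic sets and the quantities attached to them -/

/-- `p ≥ 1` and membership in `X` is ultimately `p`-periodic. -/
def HasEventualPeriod (X : Set ℕ) (p : ℕ) : Prop :=
  0 < p ∧ ∃ s : ℕ, ∀ n ≥ s, (n ∈ X ↔ n + p ∈ X)

def UltimatelyPeriodic (X : Set ℕ) : Prop := ∃ p, HasEventualPeriod X p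

/-- The (minimal) period `π_X`. -/
noncomputable def period (X : Set ℕ) : ℕ := sInf {p | HasEventualPeriod X p}

/-- The largest divisor of `m` all of whose prime factors fail to divide some coefficient. -/
def coprimePart (a : List ℤ) (m : ℕ) : ℕ :=
  ∏ q ∈ m.primeFactors \ sharedPrimes a, q ^ m.factorization q

/-- The largest exponent in `m` of a prime dividing all the coefficients. -/
def maxExponent (a : List ℤ) (m : ℕ) : ℕ := (sharedPrimes a).sup fun p => m.factorization p

/-- `Q_X`, so that `π_X = Q_X p_1^{μ_1} ⋯ p_t^{μ_t}`. -/
noncomputable def QX (a : List ℤ) (X : Set ℕ) : ℕ := coprimePart a (period X)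

/-- `X ∩ (Q ℕ + r)`. -/
def residuePart (X : Set ℕ) (Q r : ℕ) : Set ℕ := {n | n ∈ X ∧ ∃ m, n = Q * m + r}

/-- `r_X`: the least `r < Q_X` such that `X ∩ (Q_X ℕ + r)` has a period of the form
`Q_X p_1^{ν_1} ⋯ p_t^{ν_t}` with `max ν_j = max μ_j`. -/
noncomputable def rX (a : List ℤ) (X : Set ℕ) : ℕ :=
  sInf {r | r < QX a X ∧
    coprimePart a (period (residuePart X (QX a X) r)) = QX a X ∧
    maxExponent a (period (residuePart X (QX a X) r)) = maxExponent a (period X)}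

/-- `ρ_X`: the period of `X ∩ (Q_X ℕ + r_X)`. -/
noncomputable def rhoX (a : List ℤ) (X : Set ℕ) : ℕ :=
  period (residuePart X (QX a X) (rX a X))

/-- `f_p(μ)`: the length of the preperiod of `(U_i mod p^μ)` when this sequence is ultimately
zero. -/
noncomputable def zeroPreperiod (U : ℕ → ℕ) (p μ : ℕ) : ℕ :=
  sInf {m | ∀ i ≥ m, p ^ μ ∣ U i}

/-- `M_{μ,X} = max_j f_{p_j}(ν_{X,j})`, where `ν_{X,j}` is the exponent of `p_j` in `ρ_X`. -/
noncomputable def MX (U : ℕ → ℕ) (a : List ℤ) (X : Set ℕ) : ℕ :=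
  (sharedPrimes a).sup fun p => zeroPreperiod U p ((rhoX a X).factorization p)

/-- `n_X = M_{μ,X} - 1 - |rep_U(ρ_X - 1)|`, an integer. -/
noncomputable def nX (U : ℕ → ℕ) (a : List ℤ) (X : Set ℕ) : ℤ :=
  (MX U a X : ℤ) - 1 - ((rep U (rhoX a X - 1)).length : ℤ)

/-! ### Finite descriptions of automata and of numeration systems -/

/-- A finite description of a DFA with `last + 1` states over the alphabet
`{0, …, letters - 1}`. -/
structure DFACode where
  letters : ℕ
  last : ℕ
  start : ℕ
  accept : List ℕ
  table : List (List ℕ)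

namespace DFACode

def equivTuple : DFACode ≃ ℕ × ℕ × ℕ × List ℕ × List (List ℕ) where
  toFun c := (c.letters, c.last, c.start, c.accept, c.table)
  invFun t := ⟨t.1, t.2.1, t.2.2.1, t.2.2.2.1, t.2.2.2.2⟩
  left_inv _ := rfl
  right_inv _ := rfl

instance : Primcodable DFACode := Primcodable.ofEquiv _ equivTuple

/-- The DFA described by a code: `table` lists, state by state, the images under the letters. -/
def toDFA (c : DFACode) : DFA (Fin c.letters) (Fin (c.last + 1)) where
  step q x := Fin.ofNat (c.last + 1) ((c.table.getD q []).getD x 0)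
  start := Fin.ofNat (c.last + 1) c.start
  accept := {q | (q : ℕ) ∈ c.accept}

/-- The accepted language, as a set of words of natural numbers. -/
def language (c : DFACode) : Language ℕ :=
  Language.map (fun x : Fin c.letters => (x : ℕ)) c.toDFA.accepts

/-- Every DFA over `{0, …, m-1}` with state set `{0, …, n}` has a code. -/
theorem exists_code {m n : ℕ} (M : DFA (Fin m) (Fin (n + 1))) :
    ∃ (s : ℕ) (acc : List ℕ) (tab : List (List ℕ)),
      (DFACode.mk m n s acc tab).toDFA = M := by
  classical
  refine ⟨M.start, ((Finset.univ.filter (· ∈ M.accept)).toList.map (fun q => (q : ℕ))),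
    List.ofFn (fun q => List.ofFn fun x => ((M.step q x : Fin (n + 1)) : ℕ)), ?_⟩
  obtain ⟨step, start, accept⟩ := M
  simp only [toDFA, DFA.mk.injEq]
  refine ⟨?_, ?_, ?_⟩
  · funext q x
    simp [List.getD_eq_getElem?_getD, -List.ofFn_succ, Nat.le_of_lt_succ q.isLt]
  · simp
  · ext q
    simp [Fin.val_inj]

end DFACode

/-- A finite description of a linear numeration system: the coefficients `[a_0, …, a_{k-1}]` of its
recurrence relation, its first `N + k` terms, a constant `G` for (H3), and a DFA for its language
of greedy representations. -/
structure SystemCode where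
  coeffs : List ℤ
  init : List ℕ
  gapStart : ℕ
  automaton : DFACode

namespace SystemCode

def equivTuple : SystemCode ≃ List ℤ × List ℕ × ℕ × DFACode where
  toFun c := (c.coeffs, c.init, c.gapStart, c.automaton)
  invFun t := ⟨t.1, t.2.1, t.2.2.1, t.2.2.2⟩
  left_inv _ := rfl
  right_inv _ := rfl

instance : Primcodable SystemCode := Primcodable.ofEquiv _ equivTuple

/-- The code `S` describes the sequence `U` (the entry `gapStart` is constrained separately, by
`H3 U S.gapStart`). -/
structure Describes (S : SystemCode) (U : ℕ → ℕ) : Prop where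
  length_le : S.coeffs.length ≤ S.init.length
  init_eq : ∀ i < S.init.length, U i = S.init.getD i 0
  minimalRec : IsMinimalRec U S.coeffs (S.init.length - S.coeffs.length)
  automaton_spec : S.automaton.language = repLang U Set.univ

end SystemCode

/-- The set of integers recognized by a DFA: those whose greedy representation is accepted. -/
def recognizedSet (U : ℕ → ℕ) (A : DFACode) : Set ℕ := {n | rep U n ∈ A.language}

/-- `d` is a positive integer such that `n_X ≥ Z` for every ultimately periodic set `X` with
`Q_X ≤ B` and `max_j μ_{X,j} ≥ d`. -/
def IsThreshold (U : ℕ → ℕ) (a : List ℤ) (Z B d : ℕ) : Prop :=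
  0 < d ∧ ∀ X : Set ℕ, UltimatelyPeriodic X → QX a X ≤ B →
    d ≤ maxExponent a (period X) → (Z : ℤ) ≤ nX U a X

/-! ### Values of concatenations and greedy words -/

/-! The minimal period π of a recognized ultimately periodic set X has a computable bound, and
having a given eventual period is a finite check. Together these decide the question.

Bound on Q_X. By (H2), (H3) and the insertion constant, a digit 1 followed by at least Z zeros may
be put in front of every greedy word (`IsGreedy.block`). This yields prefixes with t+1 digits 1, all
at positions e with U_e ≡ U_i mod π. Two of them lead A to the same state, so X looks the same after
both, and their values agree mod π. Hence π divides (A.last+2)!·U_i for all large i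
(`exists_forall_period_dvd`). Integer combinations of shifts of U produce the impulse solution of
the recurrence times the Hankel determinant, and a prime missing some coefficient cannot divide all
late terms of the impulse solution. So Q_X divides (A.last+2)! times that determinant
(`IsMinimalRec.coprimePart_dvd`), which is nonzero because the recurrence is minimal.

Bound on the exponents of the shared primes. Take the threshold d for the bound on Q_X. If some
exponent reaches d, then n_X ≥ Z. Let l = |rep(ρ_X - 1)| and M = M_{μ,X}. There is then room for a
block with its 1 at position M - 1, the last place where U does not vanish modulo the prime powers
of ρ_X, in front of words of length l. Moving this 1 up by a period P of U mod Q_X changes the value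
mod ρ_X, so some suffix of length l detects the change. If l were large, pumping this suffix would
keep all states but push both positions beyond M, where the change is invisible mod ρ_X
(`rep_rhoX_length_lt`). So l, hence ρ_X, hence the exponents, are bounded.

Finite check. Pumping up and down preserves residues mod p and membership in X, so the numbers
between U_T and U_{2T} decide whether p is an eventual period (`hasEventualPeriod_iff_bounded`). All
bounds and tests are primitive recursive in the codes and in d. -/

theorem val_append (U : ℕ → ℕ) (u v : List ℕ) :
    val U (u ++ v) = val (fun i => U (i + v.length)) u + val U v := by
  induction u with
  | nil => simp [val]
  | cons d u ih => simp [val, ih]; ring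

theorem val_replicate_zero (U : ℕ → ℕ) (z : ℕ) : val U (List.replicate z 0) = 0 := by
  induction z with
  | zero => rfl
  | succ z ih => simp [List.replicate_succ, val, ih]

theorem val_replicate_zero_append (U : ℕ → ℕ) (z : ℕ) (w : List ℕ) :
    val U (List.replicate z 0 ++ w) = val U w := by
  rw [val_append, val_replicate_zero, Nat.zero_add]

theorem val_block (U : ℕ → ℕ) (z : ℕ) (w : List ℕ) :
    val U (1 :: (List.replicate z 0 ++ w)) = U (z + w.length) + val U w := by
  simp [val, val_replicate_zero_append]

theorem val_congr_mod {U U' : ℕ → ℕ} {Q : ℕ} (h : ∀ i, U i ≡ U' i [MOD Q]) (w : List ℕ) :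
    val U w ≡ val U' w [MOD Q] := by
  induction w with
  | nil => rfl
  | cons d w ih => exact ((h _).mul_left d).add ih

theorem modEq_add_of_dvd {U : ℕ → ℕ} {Q P pre : ℕ} (h : ∀ i ≥ pre, U (i + P) ≡ U i [MOD Q])
    {t : ℕ} (ht : P ∣ t) {i : ℕ} (hi : pre ≤ i) : U (i + t) ≡ U i [MOD Q] := by
  obtain ⟨s, rfl⟩ := ht
  induction s with
  | zero => rfl
  | succ s ih =>
    rw [Nat.mul_succ, ← Nat.add_assoc]
    exact (h (i + P * s) (le_add_right hi)).trans ih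

/-- All suffixes of `w` satisfy the greedy inequality. -/
def IsGreedy (U : ℕ → ℕ) (w : List ℕ) : Prop := ∀ v, v <:+ w → val U v < U v.length

theorem rep_length_le {U : ℕ → ℕ} {n l : ℕ} (h : n < U l) :
    (rep U n).length ≤ l := by
  rw [rep, greedyDigits_length]
  exact Nat.sInf_le h

theorem constZ_spec {U : ℕ → ℕ} {G C : ℕ} (h2 : H2 U) (h3 : H3 U G)
    {h i : ℕ} (hi : constZ U G C ≤ i) (hhi : h ≤ i) : gap U h ≤ gap U i := by
  have mono : ∀ j ≥ G, ∀ t, gap U j ≤ gap U (j + t) := by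
    intro j hj t
    induction t with
    | zero => rfl
    | succ t ih => exact ih.trans (h3 (j + t) (by omega))
  have hne : {R | G ≤ R ∧ ∀ i ≤ R, gap U i ≤ gap U R}.Nonempty := by
    -- A gap at least as large as the sum of the gaps before `G` dominates each of them; from `G` on
    -- monotonicity takes over. So the infimum in `constZ` is attained.
    obtain ⟨m, hm, hb⟩ := h2 (∑ i ∈ Finset.range G, gap U i) G
    refine ⟨m, hm, fun j hj => ?_⟩
    by_cases hjG : j < G
    · exact (Finset.single_le_sum (f := fun i => gap U i) (fun _ _ => Nat.zero_le _)
        (Finset.mem_range.2 hjG)).trans hb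
    · have := mono j (not_lt.1 hjG) (m - j)
      rwa [Nat.add_sub_cancel' hj] at this
  obtain ⟨hR1, hR2⟩ := Nat.sInf_mem hne
  have hRi := (le_max_left _ _).trans hi
  by_cases hh : h ≤ sInf {R | G ≤ R ∧ ∀ i ≤ R, gap U i ≤ gap U R}
  · have := mono _ hR1 (i - sInf {R | G ≤ R ∧ ∀ i ≤ R, gap U i ≤ gap U R})
    rw [Nat.add_sub_cancel' hRi] at this
    exact (hR2 h hh).trans this
  · have := mono h (hR1.trans (not_le.1 hh).le) (i - h)
    rwa [Nat.add_sub_cancel' hhi] at this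

theorem le_of_lt_rep_length {U : ℕ → ℕ} {n l : ℕ} (h : l < (rep U n).length) :
    U l ≤ n := by
  by_contra hc
  have := rep_length_le (not_le.1 hc)
  omega

namespace IsNumerationSystem

variable {U : ℕ → ℕ}

theorem pos (hU : IsNumerationSystem U) (i : ℕ) : 0 < U i := by
  have := hU.strictMono.monotone (Nat.zero_le i); have := hU.zero; omega

theorem lt_apply (hU : IsNumerationSystem U) (i : ℕ) : i < U i := by
  induction i with
  | zero => exact hU.pos 0
  | succ i ih => exact lt_of_le_of_lt ih (hU.strictMono (Nat.lt_succ_self i))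

theorem rep_spec (hU : IsNumerationSystem U) (n : ℕ) :
    val U (rep U n) = n ∧ (rep U n).head? ≠ some 0 ∧ IsGreedy U (rep U n) :=
  (eq_rep_iff hU n _).1 rfl

theorem mem_repLang_univ (hU : IsNumerationSystem U) (w : List ℕ) :
    w ∈ repLang U Set.univ ↔ w.head? ≠ some 0 ∧ IsGreedy U w := by
  constructor
  · rintro ⟨n, -, rfl⟩
    exact (hU.rep_spec n).2
  · rintro ⟨h1, h2⟩
    exact ⟨val U w, trivial, ((eq_rep_iff hU _ w).2 ⟨rfl, h1, h2⟩).symm⟩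

theorem rep_val (hU : IsNumerationSystem U) {w : List ℕ} (h : w ∈ repLang U Set.univ) :
    rep U (val U w) = w := by
  obtain ⟨h1, h2⟩ := (hU.mem_repLang_univ w).1 h
  exact ((eq_rep_iff hU _ w).2 ⟨rfl, h1, h2⟩).symm

theorem lt_rep_length (hU : IsNumerationSystem U) (n : ℕ) : n < U (rep U n).length := by
  have h := (hU.rep_spec n).2.2 _ (List.suffix_refl _)
  rwa [(hU.rep_spec n).1] at h

theorem lt_rep_length_of_le (hU : IsNumerationSystem U) {n l : ℕ} (h : U l ≤ n) :
    l < (rep U n).length :=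
  hU.strictMono.lt_iff_lt.1 (lt_of_le_of_lt h (hU.lt_rep_length n))

theorem rep_eq_greedyDigits (hU : IsNumerationSystem U) {n l : ℕ} (h1 : U l ≤ n)
    (h2 : n < U (l + 1)) : rep U n = greedyDigits U (l + 1) n := by
  have h3 := hU.lt_rep_length_of_le h1
  have h4 := rep_length_le h2
  rw [rep, greedyDigits_length] at h3 h4
  rw [rep, le_antisymm h4 h3]

theorem gap_add (hU : IsNumerationSystem U) (i : ℕ) : U i + gap U i = U (i + 1) := by
  have := hU.strictMono (Nat.lt_succ_self i)
  simp only [gap, Nat.succ_eq_add_one] at *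
  omega

/-- Greediness of `1 0^l rep(n)` says that `n` is below the gap at position `l + |rep(n)|`, and from
`constZ` on a gap dominates all earlier ones. -/
theorem lt_gap (hU : IsNumerationSystem U) {G C : ℕ} (h2 : H2 U) (h3 : H3 U G)
    (hC : IsInsertionBound U C) {n i : ℕ} (hi : (rep U n).length + constZ U G C ≤ i) :
    n < gap U i := by
  obtain ⟨l, hl, hw⟩ := hC.2 (rep U n) ⟨n, trivial, rfl⟩
  have hg := ((hU.mem_repLang_univ _).1 hw).2 _ (List.suffix_refl _)
  rw [val_block, (hU.rep_spec n).1] at hg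
  simp only [List.length_cons, List.length_append, List.length_replicate] at hg
  rw [← hU.gap_add] at hg
  have hCZ : C ≤ constZ U G C := le_max_right _ _
  have := constZ_spec h2 h3 (C := C) (h := l + (rep U n).length) (i := i) (by omega) (by omega)
  omega

end IsNumerationSystem

theorem IsGreedy.val_lt {U : ℕ → ℕ} {w : List ℕ} (h : IsGreedy U w) : val U w < U w.length :=
  h w (List.suffix_refl w)

theorem isGreedy_cons {U : ℕ → ℕ} {d : ℕ} {w : List ℕ} :
    IsGreedy U (d :: w) ↔ val U (d :: w) < U (w.length + 1) ∧ IsGreedy U w := by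
  constructor
  · intro h
    exact ⟨h.val_lt, fun v hv => h v (hv.trans (List.suffix_cons d w))⟩
  · rintro ⟨h1, h2⟩ v hv
    rcases List.suffix_cons_iff.1 hv with rfl | hv
    · exact h1
    · exact h2 v hv

theorem IsGreedy.replicate_zero_append {U : ℕ → ℕ} (hU : IsNumerationSystem U) {w : List ℕ}
    (h : IsGreedy U w) (z : ℕ) : IsGreedy U (List.replicate z 0 ++ w) := by
  induction z with
  | zero => simpa using h
  | succ z ih =>
    rw [List.replicate_succ, List.cons_append, isGreedy_cons]
    refine ⟨?_, ih⟩
    have := ih.val_lt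
    have := hU.strictMono (Nat.lt_succ_self (List.replicate z 0 ++ w).length)
    simp only [val, Nat.succ_eq_add_one] at *
    omega

/-- Strengthens the insertion property: every number of zeros from Z on works, not just one
particular `l`. Leading zeros in `w` are harmless, since they only make `w` longer than the
representation of its value. -/
theorem IsGreedy.block {U : ℕ → ℕ} (hU : IsNumerationSystem U) {G C : ℕ} (h2 : H2 U)
    (h3 : H3 U G) (hC : IsInsertionBound U C) {w : List ℕ} (h : IsGreedy U w) {z : ℕ}
    (hz : constZ U G C ≤ z) : IsGreedy U (1 :: (List.replicate z 0 ++ w)) := by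
  rw [isGreedy_cons]
  refine ⟨?_, h.replicate_zero_append hU z⟩
  rw [val_block]
  have h4 := rep_length_le h.val_lt
  have h5 := hU.lt_gap h2 h3 hC (n := val U w) (i := z + w.length) (by omega)
  have h6 := hU.gap_add (z + w.length)
  simp only [List.length_append, List.length_replicate]
  omega

theorem exists_greedy_word {U : ℕ → ℕ} (hU : IsNumerationSystem U) {n l : ℕ} (h : n < U l) :
    ∃ v : List ℕ, v.length = l ∧ IsGreedy U v ∧ val U v = n :=
  ⟨greedyDigits U l n, greedyDigits_length U l n, fun v hv => greedyDigits_suffix hU l n h v hv,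
    val_greedyDigits hU l n h⟩


/-! ### Runs of coded automata, and pumping -/

namespace DFACode

/-- The transition function on natural numbers; `last + 1` is a sink state that handles the
letters outside of the alphabet. -/
def stepNat (c : DFACode) (q x : ℕ) : ℕ :=
  if x < c.letters ∧ q ≤ c.last then ((c.table.getD q []).getD x 0) % (c.last + 1) else c.last + 1

def run (c : DFACode) (w : List ℕ) : ℕ := w.foldl c.stepNat (c.start % (c.last + 1))

/-- The bound on `q` matters: `accept` is an arbitrary list and may contain the sink `last + 1`. -/
def AcceptsState (c : DFACode) (q : ℕ) : Prop := q ≤ c.last ∧ q ∈ c.accept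

theorem stepNat_mem (c : DFACode) (q x : ℕ) : c.stepNat q x ∈ Finset.range (c.last + 2) := by
  rw [Finset.mem_range, stepNat]
  have := Nat.mod_lt ((c.table.getD q []).getD x 0) (show 0 < c.last + 1 by omega)
  split <;> omega

theorem run_mem (c : DFACode) (w : List ℕ) : c.run w ∈ Finset.range (c.last + 2) := by
  rcases List.eq_nil_or_concat w with rfl | ⟨w, x, rfl⟩
  · have := Nat.mod_lt c.start (show 0 < c.last + 1 by omega)
    simp only [run, List.foldl_nil, Finset.mem_range]
    omega
  · rw [List.concat_eq_append, run, List.foldl_append]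
    exact c.stepNat_mem _ _

theorem run_append_congr (c : DFACode) {u v : List ℕ} (h : c.run u = c.run v) (w : List ℕ) :
    c.run (u ++ w) = c.run (v ++ w) := by
  simp only [run, List.foldl_append] at *
  rw [h]

theorem foldl_stepNat_map (c : DFACode) (w : List (Fin c.letters)) (q : Fin (c.last + 1)) :
    (w.map (fun x : Fin c.letters => (x : ℕ))).foldl c.stepNat q =
      (c.toDFA.evalFrom q w : Fin (c.last + 1)) := by
  induction w generalizing q with
  | nil => rfl
  | cons x w ih =>
    have hx : c.stepNat q x = (c.toDFA.step q x : Fin (c.last + 1)) := by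
      simp [stepNat, toDFA, Nat.le_of_lt_succ q.isLt]
    rw [List.map_cons, List.foldl_cons, hx, ih]
    rfl

theorem foldl_stepNat_sink (c : DFACode) (w : List ℕ) :
    w.foldl c.stepNat (c.last + 1) = c.last + 1 := by
  induction w with
  | nil => rfl
  | cons x w ih => simpa [stepNat] using ih

theorem lt_letters_of_foldl_le (c : DFACode) (w : List ℕ) (q : ℕ)
    (h : w.foldl c.stepNat q ≤ c.last) : ∀ x ∈ w, x < c.letters := by
  induction w generalizing q with
  | nil => simp
  | cons x w ih =>
    rw [List.foldl_cons] at h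
    have hx : x < c.letters := by
      by_contra hc
      rw [show c.stepNat q x = c.last + 1 by simp [stepNat, hc], foldl_stepNat_sink] at h
      omega
    intro y hy
    rcases List.mem_cons.1 hy with rfl | hy
    · exact hx
    · exact ih _ h y hy

theorem mem_language_iff (c : DFACode) (w : List ℕ) :
    w ∈ c.language ↔ c.AcceptsState (c.run w) := by
  have key : ∀ w' : List (Fin c.letters), c.AcceptsState (c.run (w'.map (fun x : Fin c.letters => (x : ℕ)))) ↔
      w' ∈ c.toDFA.accepts := by
    intro w'
    have := c.foldl_stepNat_map w' c.toDFA.start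
    rw [DFA.mem_accepts, DFA.eval, run, AcceptsState,
      show c.start % (c.last + 1) = (c.toDFA.start : Fin (c.last + 1)) from rfl, this]
    exact ⟨fun h => h.2, fun h => ⟨Nat.le_of_lt_succ (Fin.isLt _), h⟩⟩
  rw [language, Language.map]
  constructor
  · rintro ⟨w', hw', rfl⟩
    exact (key w').2 hw'
  · intro h
    have hl := c.lt_letters_of_foldl_le w _ h.1
    refine ⟨w.pmap (fun x hx => (⟨x, hx⟩ : Fin c.letters)) hl, ?_, ?_⟩
    · refine (key _).1 ?_
      simpa [List.map_pmap] using h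
    · simp [List.map_pmap]

theorem mem_language_congr (c : DFACode) {u v : List ℕ} (h : c.run u = c.run v) :
    u ∈ c.language ↔ v ∈ c.language := by
  rw [mem_language_iff, mem_language_iff, h]

end DFACode

/-- In a word with a long part before its last `pre` letters, some factor of length divisible
by `P` can be pumped without changing the state and the value modulo `Q`. -/
theorem exists_pump {α : Type*} (U : ℕ → ℕ) {Q P pre : ℕ} (hQ : 0 < Q) (hP : 0 < P)
    (F : List ℕ → α) (s : Finset α) (hF : ∀ w, F w ∈ s) (v : List ℕ)
    (hlen : pre + P * (s.card * Q) ≤ v.length) :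
    ∃ a b c : List ℕ, v = a ++ b ++ c ∧ 0 < b.length ∧ P ∣ b.length ∧
      b.length ≤ P * (s.card * Q) ∧ pre ≤ c.length ∧ F (a ++ b) = F a ∧
      val U (b ++ c) ≡ val U c [MOD Q] := by
  classical
  -- Pigeonhole on the cut points `P * t`: there are `s.card * Q + 1` of them, and each is
  -- classified by `F` of the prefix and by the value of the suffix modulo `Q`.
  obtain ⟨t1, ht1, t2, ht2, hne, heq⟩ := Finset.exists_ne_map_eq_of_card_lt_of_maps_to
    (s := Finset.range (s.card * Q + 1)) (t := s ×ˢ Finset.range Q)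
    (f := fun t => (F (v.take (P * t)), val U (v.drop (P * t)) % Q))
    (by simp) (fun t _ => by simp [hF, Nat.mod_lt _ hQ])
  wlog hlt : t1 < t2 generalizing t1 t2
  · exact this t2 ht2 t1 ht1 hne.symm heq.symm (by omega)
  simp only [Prod.mk.injEq, Finset.mem_range] at heq ht1 ht2
  have h12 : P * t1 + P * (t2 - t1) = P * t2 := by
    rw [← Nat.mul_add]; congr 1; omega
  have hle : P * t2 ≤ P * (s.card * Q) := Nat.mul_le_mul_left _ (by omega)
  have hd : (v.drop (P * t1)).take (P * (t2 - t1)) ++ v.drop (P * t2) = v.drop (P * t1) := by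
    rw [← h12, ← List.drop_drop, List.take_append_drop]
  have ht : v.take (P * t1) ++ (v.drop (P * t1)).take (P * (t2 - t1)) = v.take (P * t2) := by
    rw [← h12, List.take_add]
  have hbl : ((v.drop (P * t1)).take (P * (t2 - t1))).length = P * (t2 - t1) := by
    rw [List.length_take, List.length_drop]; omega
  refine ⟨v.take (P * t1), (v.drop (P * t1)).take (P * (t2 - t1)), v.drop (P * t2), ?_, ?_, ?_,
    ?_, ?_, ?_, ?_⟩
  · rw [ht, List.take_append_drop]
  · rw [hbl]; exact Nat.mul_pos hP (by omega)
  · rw [hbl]; exact dvd_mul_right _ _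
  · rw [hbl]; omega
  · rw [List.length_drop]; omega
  · rw [ht]; exact heq.1.symm
  · rw [hd]; exact heq.2

/-- The letters before the copied factor move up by a multiple of `P` at positions beyond the
preperiod, so their weights are unchanged mod `Q`; the new lower part `b ++ c` has the value of `c`.
-/
theorem val_pump_up {U : ℕ → ℕ} {Q P pre : ℕ} (h : ∀ i ≥ pre, U (i + P) ≡ U i [MOD Q])
    {a b c : List ℕ} (hb : P ∣ b.length) (hc : pre ≤ c.length)
    (hbc : val U (b ++ c) ≡ val U c [MOD Q]) :
    val U (a ++ b ++ b ++ c) ≡ val U (a ++ b ++ c) [MOD Q] := by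
  rw [List.append_assoc (a ++ b) b c, val_append U (a ++ b), val_append U (a ++ b)]
  refine Nat.ModEq.add (val_congr_mod (fun i => ?_) _) hbc
  rw [List.length_append, Nat.add_comm b.length, ← Nat.add_assoc]
  exact modEq_add_of_dvd h hb (le_add_left hc)

theorem val_pump_down {U : ℕ → ℕ} {Q P pre : ℕ} (h : ∀ i ≥ pre, U (i + P) ≡ U i [MOD Q])
    {a b c : List ℕ} (hb : P ∣ b.length) (hc : pre ≤ c.length)
    (hbc : val U (b ++ c) ≡ val U c [MOD Q]) :
    val U (a ++ b ++ c) ≡ val U (a ++ c) [MOD Q] := by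
  rw [List.append_assoc a b c, val_append U a, val_append U a]
  refine Nat.ModEq.add (val_congr_mod (fun i => ?_) _) hbc
  rw [List.length_append, Nat.add_comm b.length, ← Nat.add_assoc]
  exact modEq_add_of_dvd h hb (le_add_left hc)


/-! ### Eventual periods -/

theorem hasEventualPeriod_iff {X : Set ℕ} {p : ℕ} :
    HasEventualPeriod X p ↔ 0 < p ∧ ∀ᶠ n in Filter.atTop, (n ∈ X ↔ n + p ∈ X) := by
  simp [HasEventualPeriod, Filter.eventually_atTop]

theorem mem_iff_of_modEq {X : Set ℕ} {p s : ℕ} (h : ∀ n ≥ s, (n ∈ X ↔ n + p ∈ X)) {n n' : ℕ}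
    (hn : s ≤ n) (hn' : s ≤ n') (hm : n ≡ n' [MOD p]) : n ∈ X ↔ n' ∈ X := by
  have key : ∀ m : ℕ, ∀ n ≥ s, (n ∈ X ↔ n + p * m ∈ X) := by
    intro m
    induction m with
    | zero => simp
    | succ m ih =>
      intro n hn
      rw [ih n hn, h _ (le_add_right hn), Nat.mul_succ, Nat.add_assoc]
  wlog hle : n ≤ n' generalizing n n'
  · exact (this hn' hn hm.symm (by omega)).symm
  obtain ⟨m, hm⟩ := (Nat.modEq_iff_dvd' hle).1 hm
  rw [key m n hn, ← hm, Nat.add_sub_cancel' hle]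

theorem HasEventualPeriod.mul {X : Set ℕ} {p m : ℕ} (h : HasEventualPeriod X p) (hm : 0 < m) :
    HasEventualPeriod X (p * m) := by
  obtain ⟨hp, s, hs⟩ := h
  refine ⟨Nat.mul_pos hp hm, s, fun n hn => mem_iff_of_modEq hs hn (by omega) ?_⟩
  simp [Nat.ModEq]

theorem HasEventualPeriod.of_dvd {X : Set ℕ} {p q : ℕ} (h : HasEventualPeriod X p) (hq : 0 < q)
    (hd : p ∣ q) : HasEventualPeriod X q := by
  obtain ⟨m, rfl⟩ := hd
  exact h.mul (Nat.pos_of_mul_pos_left hq)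

theorem HasEventualPeriod.sub {X : Set ℕ} {p q : ℕ} (hp : HasEventualPeriod X p)
    (hq : HasEventualPeriod X q) (hlt : q < p) : HasEventualPeriod X (p - q) := by
  obtain ⟨-, s, hs⟩ := hp
  obtain ⟨-, t, ht⟩ := hq
  refine ⟨by omega, s + t, fun n hn => ?_⟩
  rw [hs n (by omega), ht (n + (p - q)) (by omega), Nat.add_assoc, Nat.sub_add_cancel hlt.le]

theorem UltimatelyPeriodic.hasEventualPeriod {X : Set ℕ} (hX : UltimatelyPeriodic X) :
    HasEventualPeriod X (period X) := Nat.sInf_mem hX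

/-- Subtractive Euclid: the difference of two distinct eventual periods is again one. -/
theorem HasEventualPeriod.period_dvd {X : Set ℕ} {p : ℕ} (h : HasEventualPeriod X p) :
    period X ∣ p := by
  have hm := UltimatelyPeriodic.hasEventualPeriod ⟨p, h⟩
  induction p using Nat.strong_induction_on with
  | _ p ih =>
    have hle : period X ≤ p := Nat.sInf_le h
    rcases hle.eq_or_lt with he | hlt
    · rw [he]
    · have := ih (p - period X) (by have := hm.1; omega) (h.sub hm hlt)
      have := this.add (dvd_refl (period X))
      rwa [Nat.sub_add_cancel hle] at this

/-- Two positions beyond the preperiod starting the same window of length the minimal period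
are congruent modulo the minimal period. -/
theorem modEq_of_forall_shift {Y : Set ℕ} (hY : UltimatelyPeriodic Y) {s : ℕ}
    (hs : ∀ n ≥ s, (n ∈ Y ↔ n + period Y ∈ Y)) {n₁ n₂ : ℕ} (h₁ : s ≤ n₁) (h₂ : s ≤ n₂)
    (h : ∀ v < period Y, (n₁ + v ∈ Y ↔ n₂ + v ∈ Y)) : n₁ ≡ n₂ [MOD period Y] := by
  wlog hle : n₁ ≤ n₂ generalizing n₁ n₂
  · exact (this h₂ h₁ (fun v hv => (h v hv).symm) (by omega)).symm
  rcases hle.eq_or_lt with rfl | hlt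
  · rfl
  rw [Nat.modEq_iff_dvd' hle]
  -- The distance `n₂ - n₁` is itself an eventual period: each later position is reduced into the
  -- common window.
  refine HasEventualPeriod.period_dvd ⟨by omega, n₁, fun n hn => ?_⟩
  have hv := Nat.mod_lt (n - n₁) hY.hasEventualPeriod.1
  have hmod := Nat.mod_modEq (n - n₁) (period Y)
  have e1 : n₁ + (n - n₁) % period Y ≡ n [MOD period Y] := by
    have := hmod.add_left n₁
    rwa [Nat.add_sub_cancel' hn] at this
  have e2 : n₂ + (n - n₁) % period Y ≡ n + (n₂ - n₁) [MOD period Y] := by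
    have := hmod.add_left n₂
    rwa [show n₂ + (n - n₁) = n + (n₂ - n₁) by omega] at this
  rw [← mem_iff_of_modEq hs (by omega) (by omega) e1, ← mem_iff_of_modEq hs (by omega) (by omega) e2]
  exact h _ hv

theorem mem_residuePart {X : Set ℕ} {Q r n : ℕ} (hr : r < Q) :
    n ∈ residuePart X Q r ↔ n ∈ X ∧ n % Q = r := by
  refine and_congr_right fun _ => ⟨?_, fun h => ⟨n / Q, ?_⟩⟩
  · rintro ⟨m, rfl⟩
    rw [Nat.mul_add_mod, Nat.mod_eq_of_lt hr]
  · rw [← h, Nat.div_add_mod]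

theorem HasEventualPeriod.residuePart {X : Set ℕ} {p Q r : ℕ} (h : HasEventualPeriod X p)
    (hQ : Q ∣ p) (hr : r < Q) : HasEventualPeriod (residuePart X Q r) p := by
  obtain ⟨hp, s, hs⟩ := h
  refine ⟨hp, s, fun n hn => ?_⟩
  obtain ⟨m, rfl⟩ := hQ
  rw [mem_residuePart hr, mem_residuePart hr, hs n hn, Nat.add_mul_mod_self_left]

/-! ### The parts of an integer determined by the shared primes -/

theorem coeffGcd_dvd {a : List ℤ} {c : ℤ} (hc : c ∈ a) : coeffGcd a ∣ c.natAbs := by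
  induction a with
  | nil => simp at hc
  | cons x a ih =>
    rcases List.mem_cons.1 hc with rfl | hc
    · exact Nat.gcd_dvd_left _ _
    · exact (Nat.gcd_dvd_right _ _).trans (ih hc)

theorem dvd_coeffGcd {a : List ℤ} {d : ℕ} (h : ∀ c ∈ a, d ∣ c.natAbs) : d ∣ coeffGcd a := by
  induction a with
  | nil => simp [coeffGcd]
  | cons x a ih =>
    exact Nat.dvd_gcd (h x (by simp)) (ih fun c hc => h c (by simp [hc]))

theorem factorization_coprimePart (a : List ℤ) (m q : ℕ) :
    (coprimePart a m).factorization q = if q ∈ sharedPrimes a then 0 else m.factorization q := by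
  classical
  have h : coprimePart a m =
      (m.factorization.filter (· ∉ sharedPrimes a)).prod (fun p e => p ^ e) := by
    rw [Finsupp.prod, Finsupp.support_filter, coprimePart, Nat.support_factorization]
    refine Finset.prod_congr ?_ fun q hq => ?_
    · ext q; simp
    · rw [Finsupp.filter_apply_pos]
      simpa using (Finset.mem_filter.1 hq).2
  rw [h, Nat.prod_pow_factorization_eq_self]
  · by_cases hq : q ∈ sharedPrimes a <;> simp [hq]
  · intro p hp
    rw [Finsupp.support_filter, Nat.support_factorization] at hp
    exact Nat.prime_of_mem_primeFactors (Finset.mem_filter.1 hp).1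

theorem coprimePart_pos (a : List ℤ) (m : ℕ) : 0 < coprimePart a m :=
  Finset.prod_pos fun _ hq =>
    pow_pos (Nat.prime_of_mem_primeFactors (Finset.mem_sdiff.1 hq).1).pos _

theorem coprimePart_mul_prod (a : List ℤ) {m : ℕ} (hm : m ≠ 0) :
    coprimePart a m * ∏ p ∈ sharedPrimes a, p ^ m.factorization p = m := by
  classical
  have h1 : ∏ p ∈ sharedPrimes a, p ^ m.factorization p =
      ∏ p ∈ m.primeFactors ∩ sharedPrimes a, p ^ m.factorization p := by
    refine (Finset.prod_subset Finset.inter_subset_right fun p hp hp' => ?_).symm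
    have : m.factorization p = 0 := by
      rw [← Finsupp.notMem_support_iff, Nat.support_factorization]
      exact fun h => hp' (Finset.mem_inter.2 ⟨h, hp⟩)
    rw [this, pow_zero]
  rw [h1, coprimePart, mul_comm, Finset.prod_inter_mul_prod_sdiff]
  exact Nat.prod_factorization_pow_eq_self hm

theorem coprimePart_dvd (a : List ℤ) {m : ℕ} (hm : m ≠ 0) : coprimePart a m ∣ m :=
  Dvd.intro _ (coprimePart_mul_prod a hm)

/-- The product of the shared primes divides `a_0`, which therefore serves as a computable base. -/
theorem le_coprimePart_mul_pow {a : List ℤ} {m : ℕ} (hm : m ≠ 0) (h0 : a.getD 0 0 ≠ 0) :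
    m ≤ coprimePart a m * (a.getD 0 0).natAbs ^ maxExponent a m := by
  have hmem : a.getD 0 0 ∈ a := by
    cases a with
    | nil => simp at h0
    | cons x a => simp
  conv_lhs => rw [← coprimePart_mul_prod a hm]
  refine Nat.mul_le_mul_left _ ?_
  have hpos : 0 < (a.getD 0 0).natAbs := Int.natAbs_pos.2 h0
  calc ∏ p ∈ sharedPrimes a, p ^ m.factorization p
      ≤ ∏ p ∈ sharedPrimes a, p ^ maxExponent a m :=
        Finset.prod_le_prod' fun p hp => Nat.pow_le_pow_right
          (Nat.prime_of_mem_primeFactors hp).pos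
          (Finset.le_sup (f := fun p => m.factorization p) hp)
    _ = (∏ p ∈ sharedPrimes a, p) ^ maxExponent a m := Finset.prod_pow _ _ _
    _ ≤ _ := Nat.pow_le_pow_left (Nat.le_of_dvd hpos
        ((Nat.prod_primeFactors_dvd _).trans (coeffGcd_dvd hmem))) _

/-! ### The residue class `r_X` -/

theorem QX_pos (a : List ℤ) (X : Set ℕ) : 0 < QX a X := coprimePart_pos a _

theorem UltimatelyPeriodic.QX_dvd {X : Set ℕ} (hX : UltimatelyPeriodic X) (a : List ℤ) :
    QX a X ∣ period X := coprimePart_dvd a hX.hasEventualPeriod.1.ne'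

/-- Makes the infimum defining `rX` an attained minimum. Take a shared prime `p` of maximal exponent
in π: if every residue class lost a factor `p`, the classes together would give X the eventual
period π / p. -/
theorem UltimatelyPeriodic.exists_residue {X : Set ℕ} (hX : UltimatelyPeriodic X) {a : List ℤ}
    (hpos : 0 < maxExponent a (period X)) :
    {r | r < QX a X ∧ coprimePart a (period (residuePart X (QX a X) r)) = QX a X ∧
      maxExponent a (period (residuePart X (QX a X) r)) = maxExponent a (period X)}.Nonempty := by
  have hper := hX.hasEventualPeriod
  have hπ := hper.1
  have hQ := hX.QX_dvd a
  have hQ0 := QX_pos a X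
  obtain ⟨p, hp, hpe⟩ : ∃ p ∈ sharedPrimes a,
      maxExponent a (period X) = (period X).factorization p := by
    refine Finset.exists_mem_eq_sup _ ?_ _
    by_contra hc
    rw [Finset.not_nonempty_iff_eq_empty] at hc
    simp [maxExponent, hc] at hpos
  have hpp : p.Prime := Nat.prime_of_mem_primeFactors hp
  have hpπ : p ∣ period X := Nat.dvd_of_factorization_pos (by omega)
  have hY : ∀ r < QX a X, HasEventualPeriod (residuePart X (QX a X) r) (period X) :=
    fun r hr => hper.residuePart hQ hr
  have hYd : ∀ r < QX a X, period (residuePart X (QX a X) r) ∣ period X :=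
    fun r hr => (hY r hr).period_dvd
  have hYp : ∀ r < QX a X, HasEventualPeriod (residuePart X (QX a X) r)
      (period (residuePart X (QX a X) r)) :=
    fun r hr => UltimatelyPeriodic.hasEventualPeriod ⟨_, hY r hr⟩
  obtain ⟨r, hr, hrp⟩ : ∃ r < QX a X, (period (residuePart X (QX a X) r)).factorization p =
      (period X).factorization p := by
    by_contra! hc
    have hq : 0 < period X / p := Nat.div_pos (Nat.le_of_dvd hπ hpπ) hpp.pos
    have hQp : QX a X ∣ period X / p := by
      refine Nat.dvd_div_of_mul_dvd ?_
      refine Nat.Coprime.mul_dvd_of_dvd_of_dvd ?_ hpπ hQ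
      rw [hpp.coprime_iff_not_dvd]
      intro hd
      have := hpp.factorization_pos_of_dvd hQ0.ne' hd
      rw [QX, factorization_coprimePart, if_pos hp] at this
      omega
    have hYq : ∀ r < QX a X, HasEventualPeriod (residuePart X (QX a X) r) (period X / p) := by
      intro r hr
      refine (hYp r hr).of_dvd hq ?_
      rw [← Nat.factorization_le_iff_dvd (hYp r hr).1.ne' hq.ne']
      intro q
      have hle := (Nat.factorization_le_iff_dvd (hYp r hr).1.ne' hπ.ne').2 (hYd r hr)
      rw [Nat.factorization_div hpπ, Finsupp.tsub_apply, hpp.factorization]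
      rcases eq_or_ne q p with rfl | hqp
      · have h1 := hle q
        have h2 := hc r hr
        simp only [Finsupp.single_eq_same]
        omega
      · simpa [Finsupp.single_apply, hqp.symm] using hle q
    have hXq : HasEventualPeriod X (period X / p) := by
      rw [hasEventualPeriod_iff]
      refine ⟨hq, ?_⟩
      have : ∀ᶠ n in Filter.atTop, ∀ r ∈ Finset.range (QX a X),
          (n ∈ residuePart X (QX a X) r ↔ n + period X / p ∈ residuePart X (QX a X) r) := by
        rw [Filter.eventually_all_finset]
        exact fun r hr => (hasEventualPeriod_iff.1 (hYq r (Finset.mem_range.1 hr))).2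
      filter_upwards [this] with n hn
      have hlt := Nat.mod_lt n hQ0
      have := hn (n % QX a X) (Finset.mem_range.2 hlt)
      rw [mem_residuePart hlt, mem_residuePart hlt] at this
      obtain ⟨m, hm⟩ := hQp
      rw [hm, Nat.add_mul_mod_self_left] at this
      rw [hm]
      simpa using this
    have h1 := Nat.le_of_dvd hq hXq.period_dvd
    have h2 := Nat.div_lt_self hπ hpp.one_lt
    omega
  have hd0 := (hYp r hr).1
  refine ⟨r, hr, ?_, ?_⟩
  · have hQd : QX a X ∣ period (residuePart X (QX a X) r) := by
      obtain ⟨-, s, hs⟩ := hYp r hr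
      -- Elements of the class all agree mod Q, so a shift between two of them is a multiple of Q.
      -- If none lie beyond the preperiod, the period is 1, which contradicts the positive exponent
      -- of `p`.
      by_cases hinf : ∃ n ≥ s, n ∈ residuePart X (QX a X) r
      · obtain ⟨n, hn, hnY⟩ := hinf
        have h2 := (hs n hn).1 hnY
        rw [mem_residuePart hr] at hnY h2
        have h3 : n ≡ n + period (residuePart X (QX a X) r) [MOD QX a X] := hnY.2.trans h2.2.symm
        simpa using (Nat.modEq_iff_dvd' (Nat.le_add_right _ _)).1 h3
      · exfalso
        push Not at hinf
        have h1 : HasEventualPeriod (residuePart X (QX a X) r) 1 :=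
          ⟨one_pos, s, fun n hn => iff_of_false (hinf n hn) (hinf _ (by omega))⟩
        have h2 := Nat.dvd_one.1 h1.period_dvd
        rw [h2] at hrp
        simp at hrp
        omega
    refine Nat.eq_of_factorization_eq (coprimePart_pos _ _).ne' hQ0.ne' fun q => ?_
    rw [factorization_coprimePart]
    have h1 := (Nat.factorization_le_iff_dvd hQ0.ne' hd0.ne').2 hQd q
    have h2 := (Nat.factorization_le_iff_dvd hd0.ne' hπ.ne').2 (hYd r hr) q
    have h3 := factorization_coprimePart a (period X) q
    rw [QX] at h1 ⊢
    rw [h3] at h1 ⊢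
    split_ifs at * with hq
    · rfl
    · exact le_antisymm h2 h1
  · refine le_antisymm (Finset.sup_mono_fun fun q _ => ?_) ?_
    · exact (Nat.factorization_le_iff_dvd hd0.ne' hπ.ne').2 (hYd r hr) q
    · rw [hpe, ← hrp]
      exact Finset.le_sup (f := fun p => Nat.factorization _ p) hp

theorem UltimatelyPeriodic.rX_spec {X : Set ℕ} (hX : UltimatelyPeriodic X) {a : List ℤ}
    (hpos : 0 < maxExponent a (period X)) :
    rX a X < QX a X ∧ coprimePart a (rhoX a X) = QX a X ∧
      maxExponent a (rhoX a X) = maxExponent a (period X) :=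
  Nat.sInf_mem (hX.exists_residue hpos)


/-! ### Sequences satisfying a linear recurrence -/

theorem eq_of_linear_rec {R : Type*} [Semiring R] {k : ℕ} {c x y : ℕ → R}
    (hx : ∀ n, x (n + k) = ∑ j ∈ Finset.range k, c j * x (n + j))
    (hy : ∀ n, y (n + k) = ∑ j ∈ Finset.range k, c j * y (n + j))
    (h : ∀ i < k, x i = y i) (n : ℕ) : x n = y n := by
  induction n using Nat.strong_induction_on with
  | _ n ih =>
    by_cases hn : n < k
    · exact h n hn
    · obtain ⟨m, rfl⟩ := Nat.exists_eq_add_of_le' (not_lt.1 hn)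
      rw [hx, hy]
      refine Finset.sum_congr rfl fun j hj => ?_
      rw [ih (m + j) (by have := Finset.mem_range.1 hj; omega)]

theorem SatisfiesRec.cast {U : ℕ → ℕ} {a : List ℤ} {N : ℕ} (h : SatisfiesRec U a N) (R : Type*)
    [CommRing R] (n : ℕ) : (U (N + n + a.length) : R) =
      ∑ j ∈ Finset.range a.length, ((a.getD j 0 : ℤ) : R) * (U (N + n + j) : R) := by
  have := congrArg (Int.cast : ℤ → R) (h.2.2 (N + n) (Nat.le_add_right _ _))
  push_cast at this
  exact this

theorem SatisfiesRec.length_pos {U : ℕ → ℕ} {a : List ℤ} {N : ℕ} (h : SatisfiesRec U a N) :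
    0 < a.length := List.length_pos_of_ne_nil h.1

/-- Some window of `k` consecutive residues recurs within `Q ^ k` steps. The factorial turns the
unknown distance into one period valid for all moduli up to `B`. -/
theorem SatisfiesRec.modEq_factorial {U : ℕ → ℕ} {a : List ℤ} {N : ℕ} (h : SatisfiesRec U a N)
    {Q B : ℕ} (hQ : 0 < Q) (hQB : Q ≤ B) :
    ∀ i ≥ N + B ^ a.length, U (i + (B ^ a.length).factorial) ≡ U i [MOD Q] := by
  have : NeZero Q := ⟨hQ.ne'⟩
  have hle : Q ^ a.length ≤ B ^ a.length := Nat.pow_le_pow_left hQB _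
  obtain ⟨i, hi, j, hj, hne, heq⟩ := Finset.exists_ne_map_eq_of_card_lt_of_maps_to
    (s := Finset.range (Q ^ a.length + 1)) (t := (Finset.univ : Finset (Fin a.length → ZMod Q)))
    (f := fun i t => (U (N + i + t) : ZMod Q)) (by simp [ZMod.card]) (fun _ _ => by simp)
  wlog hlt : i < j generalizing i j
  · exact this j hj i hi hne.symm heq.symm (by omega)
  simp only [Finset.mem_range] at hi hj
  have key : ∀ n, (U (N + i + n) : ZMod Q) = U (N + j + n) := by
    refine eq_of_linear_rec (k := a.length) (c := fun t => ((a.getD t 0 : ℤ) : ZMod Q))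
      (x := fun n => (U (N + i + n) : ZMod Q)) (y := fun n => (U (N + j + n) : ZMod Q)) ?_ ?_ ?_
    · intro n
      have := h.cast (ZMod Q) (i + n)
      simpa only [← Nat.add_assoc] using this
    · intro n
      have := h.cast (ZMod Q) (j + n)
      simpa only [← Nat.add_assoc] using this
    · intro t ht
      exact congrFun heq ⟨t, ht⟩
  have hper : ∀ m ≥ N + i, U (m + (j - i)) ≡ U m [MOD Q] := by
    intro m hm
    rw [← ZMod.natCast_eq_natCast_iff]
    have := key (m - (N + i))
    rw [show N + i + (m - (N + i)) = m by omega,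
      show N + j + (m - (N + i)) = m + (j - i) by omega] at this
    exact this.symm
  intro m hm
  exact modEq_add_of_dvd hper (Nat.dvd_factorial (by omega) (by omega)) (by omega)

/-- Since `p` divides every coefficient, each use of the recurrence gains a factor `p`. -/
theorem SatisfiesRec.eventually_pow_dvd {U : ℕ → ℕ} {a : List ℤ} {N : ℕ} (h : SatisfiesRec U a N)
    {p : ℕ} (hp : p ∈ sharedPrimes a) (ν : ℕ) : ∃ m, ∀ i ≥ m, p ^ ν ∣ U i := by
  induction ν with
  | zero => exact ⟨0, by simp⟩
  | succ ν ih =>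
    obtain ⟨m, hm⟩ := ih
    refine ⟨max m N + a.length, fun i hi => ?_⟩
    obtain ⟨n, rfl⟩ := Nat.exists_eq_add_of_le' ((Nat.le_add_left _ _).trans hi)
    have hn : max m N ≤ n := by omega
    have hr := h.2.2 n ((le_max_right _ _).trans hn)
    zify
    rw [hr]
    refine Finset.dvd_sum fun j hj => ?_
    rw [pow_succ']
    refine mul_dvd_mul ?_ ?_
    · have hj' := Finset.mem_range.1 hj
      rw [Int.natCast_dvd, List.getD_eq_getElem _ _ hj']
      exact (Nat.dvd_of_mem_primeFactors hp).trans (coeffGcd_dvd (List.getElem_mem hj'))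
    · exact_mod_cast hm (n + j) ((le_max_left _ _).trans hn |>.trans (Nat.le_add_right _ _))

/-! ### The Hankel determinant -/

/-- The Hankel matrix of order `k` of the sequence `U` from the index `N` on. -/
def hankel (U : ℕ → ℕ) (N k : ℕ) : Matrix (Fin k) (Fin k) ℤ :=
  Matrix.of fun i j => (U (N + i + j) : ℤ)

section Shift

open Polynomial

/-- The shift operator on rational sequences. -/
noncomputable def seqShift : Module.End ℚ (ℕ → ℚ) := LinearMap.funLeft ℚ ℚ Nat.succ

theorem seqShift_pow_apply (u : ℕ → ℚ) (j n : ℕ) : (seqShift ^ j) u n = u (n + j) := by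
  induction j generalizing n with
  | zero => rfl
  | succ j ih =>
    rw [pow_succ', Module.End.mul_apply]
    change (seqShift ^ j) u (n + 1) = _
    rw [ih]
    congr 1
    omega

theorem aeval_seqShift_apply {f : ℚ[X]} {d : ℕ} (hd : f.natDegree < d) (u : ℕ → ℚ) (n : ℕ) :
    (aeval seqShift f) u n = ∑ j ∈ Finset.range d, f.coeff j * u (n + j) := by
  rw [aeval_eq_sum_range' hd]
  simp [LinearMap.sum_apply, Finset.sum_apply, seqShift_pow_apply]

/-- The characteristic polynomial of the recurrence relation with coefficients `a`. -/
noncomputable def recPoly (a : List ℤ) : ℤ[X] :=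
  X ^ a.length - ∑ j ∈ Finset.range a.length, C (a.getD j 0) * X ^ j

theorem degree_recPoly_tail (a : List ℤ) :
    (∑ j ∈ Finset.range a.length, C (a.getD j 0) * X ^ j : ℤ[X]).degree < a.length := by
  rw [degree_lt_iff_coeff_zero]
  intro m hm
  rw [finsetSum_coeff]
  refine Finset.sum_eq_zero fun j hj => ?_
  rw [coeff_C_mul, coeff_X_pow, if_neg (by have := Finset.mem_range.1 hj; omega), mul_zero]

theorem monic_recPoly (a : List ℤ) : (recPoly a).Monic :=
  monic_X_pow_sub (degree_recPoly_tail a)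

theorem natDegree_recPoly (a : List ℤ) : (recPoly a).natDegree = a.length := by
  refine natDegree_eq_of_degree_eq_some ?_
  rw [recPoly, degree_sub_eq_left_of_degree_lt, degree_X_pow]
  rw [degree_X_pow]
  exact degree_recPoly_tail a

theorem coeff_recPoly (a : List ℤ) {j : ℕ} (hj : j < a.length) :
    (recPoly a).coeff j = -a.getD j 0 := by
  rw [recPoly, coeff_sub, coeff_X_pow, if_neg hj.ne, finsetSum_coeff,
    Finset.sum_eq_single_of_mem j (Finset.mem_range.2 hj)]
  · simp
  · intro i _ hij
    rw [coeff_C_mul, coeff_X_pow, if_neg hij.symm, mul_zero]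

theorem aeval_recPoly_apply (a : List ℤ) (u : ℕ → ℚ) (n : ℕ) :
    (aeval seqShift ((recPoly a).map (algebraMap ℤ ℚ))) u n =
      u (n + a.length) - ∑ j ∈ Finset.range a.length, (a.getD j 0 : ℚ) * u (n + j) := by
  have hm := monic_recPoly a
  have hdeg : ((recPoly a).map (algebraMap ℤ ℚ)).natDegree < a.length + 1 := by
    rw [hm.natDegree_map, natDegree_recPoly]; omega
  have htop : (recPoly a).coeff a.length = 1 := by
    have := hm.coeff_natDegree
    rwa [natDegree_recPoly] at this
  rw [aeval_seqShift_apply hdeg, Finset.sum_range_succ, coeff_map, htop]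
  have : ∑ j ∈ Finset.range a.length, ((recPoly a).map (algebraMap ℤ ℚ)).coeff j * u (n + j) =
      -∑ j ∈ Finset.range a.length, (a.getD j 0 : ℚ) * u (n + j) := by
    rw [← Finset.sum_neg_distrib]
    refine Finset.sum_congr rfl fun j hj => ?_
    rw [coeff_map, coeff_recPoly a (Finset.mem_range.1 hj)]
    simp
  rw [this]
  simp
  ring

/-- A nonzero rational polynomial annihilating the sequence has degree at least the order of the
minimal recurrence relation. -/
theorem IsMinimalRec.length_le_natDegree {U : ℕ → ℕ} {a : List ℤ} {N : ℕ}
    (h : IsMinimalRec U a N) (hpos : ∀ i, 0 < U i) {b : ℚ[X]} (hb : b ≠ 0)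
    (hann : aeval seqShift b (fun n => (U (N + n) : ℚ)) = 0) : a.length ≤ b.natDegree := by
  obtain ⟨hrec, hmin⟩ := h
  set u : ℕ → ℚ := fun n => (U (N + n) : ℚ) with hu
  set χ := (recPoly a).map (algebraMap ℤ ℚ) with hχ
  have hχu : aeval seqShift χ u = 0 := by
    ext n
    rw [hχ, aeval_recPoly_apply, hu]
    have := hrec.cast ℚ n
    simp only [← Nat.add_assoc]
    rw [this]
    simp
  -- By Bézout the gcd annihilates the sequence too, and its degree is at most that of `b`.
  set g := EuclideanDomain.gcd b χ with hg
  have hgu : aeval seqShift g u = 0 := by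
    rw [hg, EuclideanDomain.gcd_eq_gcd_ab, mul_comm b, mul_comm χ, map_add, map_mul, map_mul,
      LinearMap.add_apply, Module.End.mul_apply, Module.End.mul_apply, hann, hχu]
    simp
  have hgχ : g ∣ χ := EuclideanDomain.gcd_dvd_right b χ
  have hgb : g ∣ b := EuclideanDomain.gcd_dvd_left b χ
  have hg0 : g ≠ 0 := ne_zero_of_dvd_ne_zero hb hgb
  -- Gauss's lemma: minimality concerns integer recurrences only, and the monic associate of a
  -- rational factor of the monic integer polynomial χ is integral.
  obtain ⟨g', hg'⟩ := IsIntegrallyClosed.eq_map_mul_C_of_dvd ℚ (monic_recPoly a) hgχ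
  have hlc : g.leadingCoeff ≠ 0 := leadingCoeff_ne_zero.2 hg0
  have hinj : Function.Injective (algebraMap ℤ ℚ) := Int.cast_injective
  have hmonic : g'.Monic := by
    refine hinj ?_
    have h1 := congrArg leadingCoeff hg'
    rw [leadingCoeff_mul, leadingCoeff_C, leadingCoeff_map_of_injective hinj] at h1
    rw [map_one]
    exact mul_right_cancel₀ hlc (by rw [h1, one_mul])
  have hdeg : (g'.map (algebraMap ℤ ℚ)).natDegree = g.natDegree := by
    conv_rhs => rw [← hg', natDegree_mul_C hlc]
  have hg'u : aeval seqShift (g'.map (algebraMap ℤ ℚ)) u = 0 := by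
    rw [← hg', mul_comm, map_mul, Module.End.mul_apply, aeval_C, Module.algebraMap_end_apply] at hgu
    exact (smul_eq_zero.1 hgu).resolve_left hlc
  have hrel : ∀ n, u (n + g'.natDegree) =
      ∑ j ∈ Finset.range g'.natDegree, -(g'.coeff j : ℚ) * u (n + j) := by
    intro n
    have h1 := congrFun hg'u n
    rw [aeval_seqShift_apply (d := g'.natDegree + 1) (by rw [hmonic.natDegree_map]; omega),
      Finset.sum_range_succ, coeff_map, hmonic.coeff_natDegree, map_one, one_mul] at h1
    simp only [coeff_map, eq_intCast, Pi.zero_apply] at h1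
    simp only [neg_mul, Finset.sum_neg_distrib]
    linarith
  have hd0 : g'.natDegree ≠ 0 := by
    intro h0
    have h1 := hrel 0
    rw [h0] at h1
    simp only [Finset.range_zero, Finset.sum_empty, hu, Nat.cast_eq_zero] at h1
    exact (hpos _).ne' h1
  -- A recurrence must have a nonzero last coefficient; here this is inherited from χ, whose
  -- constant term is `-a_0`.
  have hc0 : g'.coeff 0 ≠ 0 := by
    intro h0
    obtain ⟨f, hf⟩ := hgχ
    have h1 := congrArg (fun p => p.coeff 0) hf
    have h2 : g.coeff 0 = 0 := by
      rw [← hg', mul_coeff_zero, coeff_map, h0, map_zero, zero_mul]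
    simp only [mul_coeff_zero] at h1
    rw [h2, zero_mul, hχ, coeff_map, coeff_recPoly a hrec.length_pos] at h1
    exact hrec.2.1 (by simpa using h1)
  have hS : SatisfiesRec U ((List.range g'.natDegree).map fun j => -g'.coeff j) N := by
    refine ⟨by simpa using hd0, ?_, ?_⟩
    · rw [List.getD_eq_getElem _ _ (by simpa using Nat.pos_of_ne_zero hd0)]
      simpa using hc0
    · intro i hi
      obtain ⟨n, rfl⟩ := Nat.exists_eq_add_of_le hi
      have h1 := hrel n
      simp only [hu, ← Nat.add_assoc] at h1
      rw [List.length_map, List.length_range]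
      have h2 : ∀ j ∈ Finset.range g'.natDegree,
          ((List.range g'.natDegree).map fun j => -g'.coeff j).getD j 0 * (U (N + n + j) : ℤ) =
            -g'.coeff j * (U (N + n + j) : ℤ) := by
        intro j hj
        rw [List.getD_eq_getElem _ _ (by simpa using hj)]
        simp
      rw [Finset.sum_congr rfl h2]
      exact_mod_cast h1
  have h3 := hmin _ _ hS
  rw [List.length_map, List.length_range, ← natDegree_map_eq_of_injective hinj, hdeg] at h3
  exact h3.trans (natDegree_le_of_dvd hgb hb)

/-- A kernel vector is a polynomial of degree below `k` in the shift that sends U to a sequence with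
`k` leading zeros. That sequence obeys the same recurrence, so it vanishes, against minimality. -/
theorem IsMinimalRec.hankel_det_ne_zero {U : ℕ → ℕ} {a : List ℤ} {N : ℕ}
    (h : IsMinimalRec U a N) (hpos : ∀ i, 0 < U i) : (hankel U N a.length).det ≠ 0 := by
  intro hdet
  obtain ⟨v, hv0, hv⟩ := Matrix.exists_mulVec_eq_zero_iff.2 hdet
  set b : ℚ[X] := ∑ j : Fin a.length, C (v j : ℚ) * X ^ (j : ℕ) with hb
  have hcoeff : ∀ j : Fin a.length, b.coeff j = v j := by
    intro j
    rw [hb, finsetSum_coeff, Finset.sum_eq_single_of_mem j (Finset.mem_univ j)]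
    · simp
    · intro i _ hij
      rw [coeff_C_mul, coeff_X_pow, if_neg (fun hc => hij (Fin.ext hc.symm)), mul_zero]
  have hb0 : b ≠ 0 := by
    intro hc
    refine hv0 (funext fun j => ?_)
    have := hcoeff j
    rw [hc, coeff_zero] at this
    exact_mod_cast this.symm
  have hdeg : b.natDegree < a.length := by
    rw [natDegree_lt_iff_degree_lt hb0, degree_lt_iff_coeff_zero]
    intro m hm
    rw [hb, finsetSum_coeff]
    refine Finset.sum_eq_zero fun j _ => ?_
    rw [coeff_C_mul, coeff_X_pow, if_neg (by omega), mul_zero]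
  refine absurd (h.length_le_natDegree hpos hb0 ?_) (not_le.2 hdeg)
  set u : ℕ → ℚ := fun n => (U (N + n) : ℚ) with hu
  have hχu : aeval seqShift ((recPoly a).map (algebraMap ℤ ℚ)) u = 0 := by
    ext n
    rw [aeval_recPoly_apply, hu]
    have := h.1.cast ℚ n
    simp only [← Nat.add_assoc]
    rw [this]
    simp
  have hχw : aeval seqShift ((recPoly a).map (algebraMap ℤ ℚ)) (aeval seqShift b u) = 0 := by
    rw [← Module.End.mul_apply, ← map_mul, mul_comm, map_mul, Module.End.mul_apply, hχu, map_zero]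
  ext n
  refine eq_of_linear_rec (k := a.length) (c := fun j => (a.getD j 0 : ℚ)) (y := 0) ?_ ?_ ?_ n
  · intro m
    have := congrFun hχw m
    rw [aeval_recPoly_apply] at this
    exact sub_eq_zero.1 this
  · simp
  · intro i hi
    rw [aeval_seqShift_apply hdeg, Pi.zero_apply,
      ← Fin.sum_univ_eq_sum_range (fun j => b.coeff j * u (i + j))]
    have := congrFun hv ⟨i, hi⟩
    simp only [Matrix.mulVec, dotProduct, hankel, Matrix.of_apply, Pi.zero_apply] at this
    simp only [hcoeff, hu, ← Nat.add_assoc]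
    have h2 : ((∑ j : Fin a.length, (U (N + i + j) : ℤ) * v j : ℤ) : ℚ) = 0 := by
      rw [this]; simp
    push_cast at h2
    rw [← h2]
    exact Finset.sum_congr rfl fun j _ => mul_comm _ _

end Shift

theorem natAbs_hankel_det_le {U : ℕ → ℕ} (hU : Monotone U) (N k : ℕ) :
    (hankel U N k).det.natAbs ≤ k.factorial * U (N + 2 * k) ^ k := by
  have := Matrix.det_le (A := hankel U N k) (abv := AbsoluteValue.abs) (x := (U (N + 2 * k) : ℤ))
    (fun i j => by
      simp only [hankel, Matrix.of_apply, AbsoluteValue.abs_apply, Nat.abs_cast, Nat.cast_le]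
      exact hU (by omega))
  rw [AbsoluteValue.abs_apply, Int.abs_eq_natAbs, Fintype.card_fin, nsmul_eq_mul] at this
  exact_mod_cast this

/-- If a prime `q` fails to divide some coefficient of the recurrence relation, it fails to divide
infinitely many terms of its impulse solution. -/
theorem exists_not_dvd_impulse {k : ℕ} {c e : ℕ → ℤ}
    (he : ∀ n, e (n + k) = ∑ j ∈ Finset.range k, c j * e (n + j)) {q : ℕ} (hq : q.Prime)
    (hk : ¬ (q : ℤ) ∣ e (k - 1)) (hc : ∃ j < k, ¬ (q : ℤ) ∣ c j) (M : ℕ) :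
    ∃ n ≥ M, ¬ (q : ℤ) ∣ e n := by
  classical
  by_contra! hM
  have hqp : Prime (q : ℤ) := Nat.prime_iff_prime_int.1 hq
  set n₀ := Nat.findGreatest (fun n => ¬ (q : ℤ) ∣ e n) (M + k) with hn₀
  have h1 : ¬ (q : ℤ) ∣ e n₀ :=
    Nat.findGreatest_spec (P := fun n => ¬ (q : ℤ) ∣ e n) (m := k - 1) (by omega) hk
  have h2 : k - 1 ≤ n₀ := Nat.le_findGreatest (by omega) hk
  have h3 : ∀ n > n₀, (q : ℤ) ∣ e n := by
    intro n hn
    by_cases hnM : n ≤ M + k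
    · exact not_not.1 (Nat.findGreatest_is_greatest hn hnM)
    · exact hM n (by omega)
  -- With `n₀` the last index where `q` does not divide `e` and `j` the first one where it does not
  -- divide `c`, the recurrence at `n₀ - j` has `c j * e n₀` as its only term not divisible by `q`.
  set j := Nat.find hc with hj
  obtain ⟨hjk, hjc⟩ := Nat.find_spec hc
  have h4 : ∀ i < j, (q : ℤ) ∣ c i := by
    intro i hi
    have := Nat.find_min hc hi
    push Not at this
    exact this (by omega)
  have h5 := he (n₀ - j)
  rw [← Finset.add_sum_erase _ _ (Finset.mem_range.2 hjk)] at h5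
  have h6 : (q : ℤ) ∣ ∑ i ∈ (Finset.range k).erase j, c i * e (n₀ - j + i) := by
    refine Finset.dvd_sum fun i hi => ?_
    rw [Finset.mem_erase, Finset.mem_range] at hi
    rcases lt_or_gt_of_ne hi.1 with hlt | hgt
    · exact (h4 i hlt).mul_right _
    · exact (h3 _ (by omega)).mul_left _
  have h7 : (q : ℤ) ∣ e (n₀ - j + k) := h3 _ (by omega)
  rw [h5, dvd_add_left h6, show n₀ - j + j = n₀ by omega] at h7
  rcases hqp.dvd_or_dvd h7 with h8 | h8
  · exact hjc h8
  · exact h1 h8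

theorem exists_getD_not_dvd {a : List ℤ} (h0 : coeffGcd a ≠ 0) {q : ℕ} (hq : q.Prime)
    (hqa : q ∉ sharedPrimes a) : ∃ j < a.length, ¬ (q : ℤ) ∣ a.getD j 0 := by
  by_contra! hc
  refine hqa (Nat.mem_primeFactors.2 ⟨hq, dvd_coeffGcd fun x hx => ?_, h0⟩)
  obtain ⟨j, hj, rfl⟩ := List.getElem_of_mem hx
  have := hc j hj
  rwa [List.getD_eq_getElem _ _ hj, Int.natCast_dvd] at this

/-- The last column of the adjugate combines shifts of U into a solution `y` starting with 0, …, 0,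
det. Then `e = y / det` is the impulse solution, and a prime power `q ^ E` dividing `F * det * e n`
with `q` not dividing `e n` divides `F * det`. -/
theorem IsMinimalRec.coprimePart_dvd {U : ℕ → ℕ} {a : List ℤ} {N : ℕ}
    (h : IsMinimalRec U a N) (hpos : ∀ i, 0 < U i) (h0 : coeffGcd a ≠ 0) {m F I : ℕ}
    (hdvd : ∀ i ≥ I, m ∣ F * U i) (hm : m ≠ 0) :
    coprimePart a m ∣ F * (hankel U N a.length).det.natAbs := by
  have hk := h.1.length_pos
  set k := a.length with hkdef
  set H := hankel U N k with hH
  set t : Fin k := ⟨k - 1, by omega⟩ with ht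
  set y : ℕ → ℤ := fun n => ∑ j : Fin k, (U (N + n + j) : ℤ) * H.adjugate j t with hy
  have hyrec : ∀ n, y (n + k) = ∑ i ∈ Finset.range k, a.getD i 0 * y (n + i) := by
    intro n
    simp only [hy, Finset.mul_sum]
    rw [Finset.sum_comm]
    refine Finset.sum_congr rfl fun j _ => ?_
    have := h.1.cast ℤ (n + j)
    rw [← hkdef, show N + (n + j) + k = N + (n + k) + j by omega] at this
    rw [this, Finset.sum_mul]
    refine Finset.sum_congr rfl fun i _ => ?_
    rw [show N + (n + (j : ℕ)) + i = N + (n + i) + j by omega, Int.cast_id]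
    ring
  have hyinit : ∀ i : Fin k, y i = if i = t then H.det else 0 := by
    intro i
    have h1 := congrFun (congrFun (Matrix.mul_adjugate H) i) t
    rw [Matrix.mul_apply, Matrix.smul_apply, Matrix.one_apply] at h1
    simp only [hy]
    rw [show (∑ j : Fin k, (U (N + i + j) : ℤ) * H.adjugate j t) =
      ∑ j, H i j * H.adjugate j t from rfl, h1]
    simp
  have hdiv : ∀ n, H.det ∣ y n := by
    intro n
    induction n using Nat.strong_induction_on with
    | _ n ih =>
      by_cases hn : n < k
      · have := hyinit ⟨n, hn⟩
        simp only at this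
        rw [this]
        split <;> simp
      · obtain ⟨l, rfl⟩ := Nat.exists_eq_add_of_le' (not_lt.1 hn)
        rw [hyrec]
        exact Finset.dvd_sum fun j hj =>
          (ih _ (by have := Finset.mem_range.1 hj; omega)).mul_left _
  choose e he using hdiv
  have hdet := h.hankel_det_ne_zero hpos
  rw [← hkdef, ← hH] at hdet
  have herec : ∀ n, e (n + k) = ∑ i ∈ Finset.range k, a.getD i 0 * e (n + i) := by
    intro n
    refine mul_left_cancel₀ hdet ?_
    rw [← he, hyrec, Finset.mul_sum]
    refine Finset.sum_congr rfl fun i _ => ?_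
    rw [he]; ring
  have he1 : e (k - 1) = 1 := by
    refine mul_left_cancel₀ hdet ?_
    have := hyinit t
    rw [if_pos rfl] at this
    rw [← he, mul_one]
    exact this
  rw [Nat.dvd_iff_prime_pow_dvd_dvd]
  intro q E hq hqE
  rcases Nat.eq_zero_or_pos E with rfl | hE
  · simp
  have hqa : q ∉ sharedPrimes a := by
    intro hc
    have h1 := hq.factorization_pos_of_dvd (coprimePart_pos a m).ne'
      ((dvd_pow_self q hE.ne').trans hqE)
    rw [factorization_coprimePart, if_pos hc] at h1
    exact lt_irrefl _ h1
  obtain ⟨n, hn, hqn⟩ := exists_not_dvd_impulse herec hq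
    (by rw [he1]; exact fun hc => hq.one_lt.ne' (by simpa using Int.natCast_dvd.1 hc))
    (exists_getD_not_dvd h0 hq hqa) I
  have h2 : ((q ^ E : ℕ) : ℤ) ∣ (F : ℤ) * y n := by
    simp only [hy, Finset.mul_sum]
    refine Finset.dvd_sum fun j _ => ?_
    rw [← mul_assoc]
    refine Dvd.dvd.mul_right ?_ _
    exact_mod_cast (hqE.trans (_root_.coprimePart_dvd a hm)).trans (hdvd _ (by omega))
  rw [he, ← mul_assoc] at h2
  have hcop : IsCoprime ((q ^ E : ℕ) : ℤ) (e n) := by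
    rw [Nat.cast_pow]
    refine IsCoprime.pow_left ?_
    exact (Nat.prime_iff_prime_int.1 hq).irreducible.coprime_iff_not_dvd.2 hqn
  have h3 := hcop.dvd_of_dvd_mul_right h2
  rw [Int.natCast_dvd, Int.natAbs_mul, Int.natAbs_natCast] at h3
  exact h3


/-! ### Bounding the period of a recognized ultimately periodic set -/

theorem IsNumerationSystem.val_mem_recognizedSet {U : ℕ → ℕ} (hU : IsNumerationSystem U)
    (A : DFACode) {w : List ℕ} (hw : w ∈ repLang U Set.univ) :
    val U w ∈ recognizedSet U A ↔ w ∈ A.language := by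
  rw [recognizedSet, Set.mem_ofPred_eq, hU.rep_val hw]

/-- There are finitely many residues, and those taken only finitely often eventually disappear. -/
theorem exists_forall_recurrent (U : ℕ → ℕ) {m : ℕ} (hm : 0 < m) :
    ∃ I, ∀ i ≥ I, ∀ M, ∃ j ≥ M, U j ≡ U i [MOD m] := by
  have h : ∀ᶠ i in Filter.atTop, ∀ r ∈ Finset.range m,
      U i % m = r → ∀ M, ∃ j ≥ M, U j % m = r := by
    rw [Filter.eventually_all_finset]
    intro r _
    by_cases hr : ∀ M, ∃ j ≥ M, U j % m = r
    · exact Filter.Eventually.of_forall fun i _ => hr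
    · push Not at hr
      obtain ⟨M, hM⟩ := hr
      filter_upwards [Filter.eventually_ge_atTop M] with i hi hir
      exact absurd hir (hM i hi)
  obtain ⟨I, hI⟩ := Filter.eventually_atTop.1 h
  exact ⟨I, fun i hi M => hI i hi _ (Finset.mem_range.2 (Nat.mod_lt _ hm)) rfl M⟩

/-- The prefix consists of `t + 1` digits 1 at positions whose terms are congruent to `U i`, each
followed by at least Z zeros. The lower bound `s` will put the values beyond the preperiod of X. -/
theorem exists_prefix_modEq_mul {U : ℕ → ℕ} (hU : IsNumerationSystem U) {G C : ℕ} (h2 : H2 U)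
    (h3 : H3 U G) (hC : IsInsertionBound U C) {m i : ℕ}
    (hi : ∀ M, ∃ j ≥ M, U j ≡ U i [MOD m]) (l s t : ℕ) :
    ∃ (x : List ℕ) (V : ℕ), s ≤ V ∧ V ≡ (t + 1) * U i [MOD m] ∧ ∀ v, v.length = l →
      IsGreedy U v → x ++ v ∈ repLang U Set.univ ∧ val U (x ++ v) = V + val U v := by
  induction t with
  | zero =>
    obtain ⟨e, he, hei⟩ := hi (l + constZ U G C + s)
    refine ⟨1 :: List.replicate (e - l) 0, U e, ?_, by simpa using hei, fun v hv hg => ⟨?_, ?_⟩⟩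
    · exact le_trans (by omega) (hU.lt_apply e).le
    · rw [hU.mem_repLang_univ]
      exact ⟨by simp, hg.block hU h2 h3 hC (by omega)⟩
    · rw [List.cons_append, val_block, hv, Nat.sub_add_cancel (by omega)]
  | succ t ih =>
    obtain ⟨x, V, hs, hV, hx⟩ := ih
    obtain ⟨e, he, hei⟩ := hi (x.length + l + constZ U G C)
    refine ⟨1 :: (List.replicate (e - (x.length + l)) 0 ++ x), U e + V, by omega, ?_,
      fun v hv hg => ⟨?_, ?_⟩⟩
    · have := hei.add hV
      rwa [show U i + (t + 1) * U i = (t + 1 + 1) * U i by ring] at this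
    · rw [hU.mem_repLang_univ, List.cons_append, List.append_assoc]
      exact ⟨by simp, ((hU.mem_repLang_univ _).1 (hx v hv hg).1).2.block hU h2 h3 hC (by omega)⟩
    · rw [List.cons_append, List.append_assoc, val_block, (hx v hv hg).2, List.length_append, hv,
        Nat.sub_add_cancel (by omega), Nat.add_assoc]

theorem exists_forall_period_dvd {U : ℕ → ℕ} (hU : IsNumerationSystem U) {G C : ℕ} (h2 : H2 U)
    (h3 : H3 U G) (hC : IsInsertionBound U C) {A : DFACode}
    (hX : UltimatelyPeriodic (recognizedSet U A)) :
    ∃ I, ∀ i ≥ I, period (recognizedSet U A) ∣ (A.last + 2).factorial * U i := by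
  set π := period (recognizedSet U A) with hπ
  obtain ⟨hpos, s, hs⟩ := hX.hasEventualPeriod
  obtain ⟨I, hI⟩ := exists_forall_recurrent U hpos
  refine ⟨I, fun i hi => ?_⟩
  -- Suffixes of length `π` suffice to represent every `v < π`, because `π < U π`.
  choose x V hsV hV hx using exists_prefix_modEq_mul hU h2 h3 hC (hI i hi) π s
  obtain ⟨t₁, ht₁, t₂, ht₂, hne, heq⟩ := Finset.exists_ne_map_eq_of_card_lt_of_maps_to
    (s := Finset.range (A.last + 3)) (t := Finset.range (A.last + 2))
    (f := fun t => A.run (x t)) (by simp) (fun t _ => A.run_mem _)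
  wlog hlt : t₁ < t₂ generalizing t₁ t₂
  · exact this t₂ ht₂ t₁ ht₁ hne.symm heq.symm (by omega)
  simp only [Finset.mem_range] at ht₁ ht₂
  have hmod : V t₁ ≡ V t₂ [MOD π] := by
    refine modEq_of_forall_shift hX hs (hsV _) (hsV _) fun v hv => ?_
    obtain ⟨w, hwl, hwg, rfl⟩ := exists_greedy_word hU (hv.trans (hU.lt_apply _))
    rw [← (hx t₁ w hwl hwg).2, ← (hx t₂ w hwl hwg).2,
      hU.val_mem_recognizedSet A (hx t₁ w hwl hwg).1,
      hU.val_mem_recognizedSet A (hx t₂ w hwl hwg).1]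
    exact A.mem_language_congr (A.run_append_congr heq w)
  have h4 : (t₁ + 1) * U i ≡ (t₂ + 1) * U i [MOD π] := ((hV t₁).symm.trans hmod).trans (hV t₂)
  have h5 := (Nat.modEq_iff_dvd' (Nat.mul_le_mul_right _ (by omega))).1 h4
  rw [← Nat.mul_sub_right_distrib] at h5
  exact h5.trans (Nat.mul_dvd_mul_right (Nat.dvd_factorial (by omega) (by omega)) _)

/-- A bound for `Q_X`, for the set `X` recognized by `A`. -/
def boundQ (U : ℕ → ℕ) (k N : ℕ) (A : DFACode) : ℕ :=
  (A.last + 2).factorial * (k.factorial * U (N + 2 * k) ^ k)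

theorem QX_le_boundQ {U : ℕ → ℕ} (hU : IsNumerationSystem U) {G C : ℕ} (h2 : H2 U)
    (h3 : H3 U G) (hC : IsInsertionBound U C) {a : List ℤ} {N : ℕ} (ha : IsMinimalRec U a N)
    (h0 : coeffGcd a ≠ 0) {A : DFACode} (hX : UltimatelyPeriodic (recognizedSet U A)) :
    QX a (recognizedSet U A) ≤ boundQ U a.length N A := by
  obtain ⟨I, hI⟩ := exists_forall_period_dvd hU h2 h3 hC hX
  have h4 := ha.coprimePart_dvd hU.pos h0 hI hX.hasEventualPeriod.1.ne'
  have h5 := Int.natAbs_pos.2 (ha.hankel_det_ne_zero hU.pos)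
  exact (Nat.le_of_dvd (Nat.mul_pos (Nat.factorial_pos _) h5) h4).trans
    (Nat.mul_le_mul_left _ (natAbs_hankel_det_le hU.strictMono.monotone N a.length))

/-- The word `1 0^m 1 0^n`. -/
def twoBlock (m n : ℕ) : List ℕ := 1 :: (List.replicate m 0 ++ 1 :: List.replicate n 0)

theorem twoBlock_append (m n : ℕ) (v : List ℕ) : twoBlock m n ++ v =
    1 :: (List.replicate m 0 ++ 1 :: (List.replicate n 0 ++ v)) := by
  simp [twoBlock]

theorem val_twoBlock_append (U : ℕ → ℕ) (m n : ℕ) (v : List ℕ) :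
    val U (twoBlock m n ++ v) = U (m + (n + v.length + 1)) + U (n + v.length) + val U v := by
  rw [twoBlock_append, val_block, val_block]
  simp [Nat.add_assoc]

theorem twoBlock_append_mem {U : ℕ → ℕ} (hU : IsNumerationSystem U) {G C : ℕ} (h2 : H2 U)
    (h3 : H3 U G) (hC : IsInsertionBound U C) {m n : ℕ} (hm : constZ U G C ≤ m)
    (hn : constZ U G C ≤ n) {v : List ℕ} (hv : IsGreedy U v) :
    twoBlock m n ++ v ∈ repLang U Set.univ := by
  rw [hU.mem_repLang_univ, twoBlock_append]
  exact ⟨by simp, (hv.block hU h2 h3 hC hn).block hU h2 h3 hC hm⟩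

theorem coprime_coprimePart (a : List ℤ) (m e : ℕ) {p : ℕ} (hp : p ∈ sharedPrimes a) :
    Nat.Coprime (coprimePart a m) (p ^ e) := by
  have hpp := Nat.prime_of_mem_primeFactors hp
  refine Nat.Coprime.pow_right _ ((hpp.coprime_iff_not_dvd.2 fun hd => ?_).symm)
  have := hpp.factorization_pos_of_dvd (coprimePart_pos a m).ne' hd
  rw [factorization_coprimePart, if_pos hp] at this
  exact lt_irrefl _ this

/-- `M_{μ,X}` is the exact preperiod of `U` modulo the prime powers dividing `ρ_X`. -/
theorem SatisfiesRec.MX_spec {U : ℕ → ℕ} {a : List ℤ} {N : ℕ} (ha : SatisfiesRec U a N)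
    (X : Set ℕ) (hM : 0 < MX U a X) :
    (∀ i ≥ MX U a X, ∀ p ∈ sharedPrimes a, p ^ (rhoX a X).factorization p ∣ U i) ∧
      ∃ p ∈ sharedPrimes a, ¬ p ^ (rhoX a X).factorization p ∣ U (MX U a X - 1) := by
  have hz : ∀ p ∈ sharedPrimes a, ∀ i ≥ zeroPreperiod U p ((rhoX a X).factorization p),
      p ^ (rhoX a X).factorization p ∣ U i :=
    fun p hp => Nat.sInf_mem (ha.eventually_pow_dvd hp _)
  have hdvd : ∀ i ≥ MX U a X, ∀ p ∈ sharedPrimes a, p ^ (rhoX a X).factorization p ∣ U i :=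
    fun i hi p hp => hz p hp i ((Finset.le_sup
      (f := fun p => zeroPreperiod U p ((rhoX a X).factorization p)) hp).trans hi)
  refine ⟨hdvd, ?_⟩
  obtain ⟨p, hp, hpM⟩ : ∃ p ∈ sharedPrimes a,
      MX U a X = zeroPreperiod U p ((rhoX a X).factorization p) := by
    refine Finset.exists_mem_eq_sup _ ?_ _
    by_contra hc
    rw [Finset.not_nonempty_iff_eq_empty] at hc
    simp [MX, hc] at hM
  refine ⟨p, hp, fun hd => ?_⟩
  have hle : zeroPreperiod U p ((rhoX a X).factorization p) ≤ MX U a X - 1 := by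
    refine Nat.sInf_le fun i hi => ?_
    rcases (show MX U a X - 1 ≤ i from hi).eq_or_lt with rfl | hlt
    · exact hd
    · exact hdvd i (by omega) p hp
  omega

/-- The automaton `c` certifies that pumped words stay greedy. The square in the bound comes from
running both automata behind two prefixes at once. -/
theorem rep_rhoX_length_lt {U : ℕ → ℕ} (hU : IsNumerationSystem U) {G C : ℕ} (h2 : H2 U)
    (h3 : H3 U G) (hC : IsInsertionBound U C) {a : List ℤ} {N : ℕ} (ha : SatisfiesRec U a N)
    {A c : DFACode} (hc : c.language = repLang U Set.univ)
    (hX : UltimatelyPeriodic (recognizedSet U A))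
    (hpos : 0 < maxExponent a (period (recognizedSet U A)))
    (hn : (constZ U G C : ℤ) ≤ nX U a (recognizedSet U A)) {P pre : ℕ} (hP : 0 < P)
    (hper : ∀ i ≥ pre, U (i + P) ≡ U i [MOD QX a (recognizedSet U A)]) :
    (rep U (rhoX a (recognizedSet U A) - 1)).length <
      pre + P * ((A.last + 2) * (c.last + 2) * ((A.last + 2) * (c.last + 2)) *
        QX a (recognizedSet U A)) := by
  classical
  by_contra hlen
  rw [not_lt] at hlen
  set X := recognizedSet U A with hXdef
  set Q := QX a X with hQ
  set ρ := rhoX a X with hρ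
  set r := rX a X with hrdef
  set l := (rep U (ρ - 1)).length with hl
  set Z := constZ U G C with hZ
  set M := MX U a X with hMdef
  obtain ⟨hr, hρQ, -⟩ := hX.rX_spec hpos
  change r < Q at hr
  have hQ0 : 0 < Q := QX_pos a X
  have hY : UltimatelyPeriodic (residuePart X Q r) :=
    ⟨_, hX.hasEventualPeriod.residuePart (hX.QX_dvd a) hr⟩
  obtain ⟨hρ0, s, hs⟩ := hY.hasEventualPeriod
  change 0 < ρ at hρ0
  have hZ1 : 0 < Z := lt_of_lt_of_le hC.1 (le_max_right _ _)
  -- Here `n = n_X`: in front of `l` letters, the 1 of the block `1 0^n` stands at position `M - 1`.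
  obtain ⟨n, hZn, hMn⟩ : ∃ n, Z ≤ n ∧ M = n + l + 1 := by
    have hn' : (Z : ℤ) ≤ (M : ℤ) - 1 - (l : ℤ) := hn
    exact ⟨M - 1 - l, by omega, by omega⟩
  obtain ⟨hdvd, p, hp, hpM⟩ := ha.MX_spec X (by omega)
  rw [← hMdef, ← hρ] at hdvd hpM
  rw [show M - 1 = n + l by omega] at hpM
  have hρfac : Q * ∏ p ∈ sharedPrimes a, p ^ ρ.factorization p = ρ := by
    have := coprimePart_mul_prod a hρ0.ne'
    rwa [hρQ] at this
  -- congruence modulo the period beyond the preperiod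
  have hmodρ : ∀ i j, M ≤ i → M ≤ j → U i ≡ U j [MOD Q] → U i ≡ U j [MOD ρ] := by
    intro i j hi hj hij
    rw [← hρfac]
    have hcop : Nat.Coprime Q (∏ p ∈ sharedPrimes a, p ^ ρ.factorization p) := by
      refine Nat.Coprime.prod_right fun q hq => ?_
      exact coprime_coprimePart a _ _ hq
    have hR : ∀ i ≥ M, (∏ p ∈ sharedPrimes a, p ^ ρ.factorization p) ∣ U i := by
      intro i hi
      refine Finset.prod_dvd_of_isRelPrime ?_ (hdvd i hi)
      intro q hq q' hq' hne
      rw [Function.onFun, ← Nat.coprime_iff_isRelPrime]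
      exact Nat.coprime_pow_primes _ _ (Nat.prime_of_mem_primeFactors hq)
        (Nat.prime_of_mem_primeFactors hq') hne
    refine (Nat.modEq_and_modEq_iff_modEq_mul hcop).1 ⟨hij, ?_⟩
    exact (Nat.modEq_zero_iff_dvd.2 (hR i hi)).trans (Nat.modEq_zero_iff_dvd.2 (hR j hj)).symm
  obtain ⟨e, he⟩ : ∃ e, e = M + P + Z + s + pre := ⟨_, rfl⟩
  have hes : s ≤ U e := le_trans (by omega) (hU.lt_apply e).le
  have hval₁ : ∀ v : List ℕ, val U (twoBlock (e - M) n ++ v) =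
      U (e - l + v.length) + U (n + v.length) + val U v := by
    intro v
    rw [val_twoBlock_append, show e - M + (n + v.length + 1) = e - l + v.length by omega]
  have hval₂ : ∀ v : List ℕ, val U (twoBlock (e - M - P) (n + P) ++ v) =
      U (e - l + v.length) + U (n + v.length + P) + val U v := by
    intro v
    rw [val_twoBlock_append, show e - M - P + (n + P + v.length + 1) = e - l + v.length by omega,
      show n + P + v.length = n + v.length + P by omega]
  -- a word that distinguishes the two prefixes
  have hne : ¬ U e + U (n + l) ≡ U e + U (n + l + P) [MOD ρ] := by
    intro hcon
    have h4 := (Nat.ModEq.add_left_cancel' _ hcon).of_dvd (Nat.ordProj_dvd ρ p)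
    exact hpM (Nat.modEq_zero_iff_dvd.1
      (h4.trans (Nat.modEq_zero_iff_dvd.2 (hdvd _ (by omega) p hp))))
  obtain ⟨v₀, hv₀, hvX⟩ : ∃ v₀ < ρ, ¬ (U e + U (n + l) + v₀ ∈ residuePart X Q r ↔
      U e + U (n + l + P) + v₀ ∈ residuePart X Q r) := by
    by_contra! hcon
    exact hne (modEq_of_forall_shift hY hs (by omega) (by omega) hcon)
  have hmodQ : U e + U (n + l + P) + v₀ ≡ U e + U (n + l) + v₀ [MOD Q] :=
    ((hper (n + l) (by omega)).add_left _).add_right _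
  rw [mem_residuePart hr, mem_residuePart hr, hmodQ] at hvX
  -- The two numbers agree mod Q, so both lie in the class `r`; it is membership in X that separates
  -- them.
  have hres : (U e + U (n + l) + v₀) % Q = r := by
    by_contra hcon
    exact hvX (iff_of_false (fun h => hcon h.2) fun h => hcon h.2)
  obtain ⟨v, hvl, hvg, rfl⟩ := exists_greedy_word hU
    (show v₀ < U l from lt_of_le_of_lt (by omega) (hU.lt_rep_length (ρ - 1)))
  -- pumping
  let τ : List ℕ → ℕ × ℕ := fun w => (A.run w, c.run w)
  obtain ⟨x, y, z, rfl, hy0, hPy, -, hz, hF, hyz⟩ := exists_pump U hQ0 hP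
    (fun w => (τ (twoBlock (e - M) n ++ w), τ (twoBlock (e - M - P) (n + P) ++ w)))
    ((Finset.range (A.last + 2) ×ˢ Finset.range (c.last + 2)) ×ˢ
      (Finset.range (A.last + 2) ×ˢ Finset.range (c.last + 2)))
    (fun w => by simp only [Finset.mem_product, τ, DFACode.run_mem, and_self]) v
    (by simpa [hvl] using hlen)
  simp only [Prod.mk.injEq, τ] at hF
  obtain ⟨⟨hA₁, hc₁⟩, hA₂, hc₂⟩ := hF
  have hpump : ∀ u : List ℕ, A.run (u ++ (x ++ y)) = A.run (u ++ x) →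
      c.run (u ++ (x ++ y)) = c.run (u ++ x) → u ++ (x ++ y ++ z) ∈ repLang U Set.univ →
      (val U (u ++ (x ++ y ++ y ++ z)) ∈ X ↔ val U (u ++ (x ++ y ++ z)) ∈ X) := by
    intro u hAu hcu hu
    have e1 : u ++ (x ++ y ++ y ++ z) = u ++ (x ++ y) ++ (y ++ z) := by simp
    have e2 : u ++ (x ++ y ++ z) = u ++ x ++ (y ++ z) := by simp
    have h5 : u ++ (x ++ y ++ y ++ z) ∈ repLang U Set.univ := by
      rw [← hc] at hu ⊢
      rw [e1]
      rw [e2] at hu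
      exact (c.mem_language_congr (c.run_append_congr hcu _)).2 hu
    rw [hU.val_mem_recognizedSet A h5, hU.val_mem_recognizedSet A hu, e1, e2]
    exact A.mem_language_congr (A.run_append_congr hAu _)
  have h₁ := hpump _ hA₁ hc₁ (twoBlock_append_mem hU h2 h3 hC (by omega) hZn hvg)
  have h₂ := hpump _ hA₂ hc₂ (twoBlock_append_mem hU h2 h3 hC (by omega) (by omega) hvg)
  have hpl : (x ++ y ++ y ++ z).length = l + y.length := by
    simp only [List.length_append] at hvl ⊢; omega
  have hpv := val_pump_up hper (a := x) hPy hz hyz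
  rw [hval₁, hval₁, hpl, hvl, show e - l + l = e by omega,
    show e - l + (l + y.length) = e + y.length by omega, ← Nat.add_assoc n] at h₁
  rw [hval₂, hval₂, hpl, hvl, show e - l + l = e by omega,
    show e - l + (l + y.length) = e + y.length by omega, ← Nat.add_assoc n] at h₂
  have hres₁ : (U (e + y.length) + U (n + l + y.length) + val U (x ++ y ++ y ++ z)) % Q = r := by
    rw [← hres]
    exact ((modEq_add_of_dvd hper hPy (by omega)).add (modEq_add_of_dvd hper hPy (by omega))).add hpv
  -- After pumping, the moved 1 stands at position at least `M` in both words, where congruence mod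
  -- Q already gives congruence mod ρ.
  have hcong : U (e + y.length) + U (n + l + y.length + P) + val U (x ++ y ++ y ++ z) ≡
      U (e + y.length) + U (n + l + y.length) + val U (x ++ y ++ y ++ z) [MOD ρ] :=
    ((hmodρ _ _ (by omega) (by omega) (hper _ (by omega))).add_left _).add_right _
  have hres₂ : (U (e + y.length) + U (n + l + y.length + P) + val U (x ++ y ++ y ++ z)) % Q = r := by
    rw [← hres₁]
    exact hcong.of_dvd (Dvd.intro _ hρfac)
  have hUe : U e ≤ U (e + y.length) := hU.strictMono.monotone (by omega)
  have hfin := mem_iff_of_modEq hs (by omega) (by omega) hcong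
  rw [mem_residuePart hr, mem_residuePart hr] at hfin
  simp only [hres₁, hres₂, and_true] at hfin
  refine hvX (and_congr_left fun _ => ?_)
  rw [← h₁, ← h₂, hfin]

/-- A bound for the length of the representation of `ρ_X - 1`. -/
def boundLength (U : ℕ → ℕ) (k N : ℕ) (A c : DFACode) : ℕ :=
  N + boundQ U k N A ^ k + (boundQ U k N A ^ k).factorial *
    ((A.last + 2) * (c.last + 2) * ((A.last + 2) * (c.last + 2)) * boundQ U k N A)

/-- A bound for the period; `b` is the absolute value of the last coefficient. -/
def boundPeriod (U : ℕ → ℕ) (k N b : ℕ) (A c : DFACode) (d : ℕ) : ℕ :=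
  boundQ U k N A * b ^ (d + U (boundLength U k N A c))

/-- The exponent `d + U (boundLength …)` covers both cases: exponents below the threshold, and
exponents bounded through the size of ρ_X. -/
theorem period_le_boundPeriod {U : ℕ → ℕ} (hU : IsNumerationSystem U) {G C : ℕ} (h2 : H2 U)
    (h3 : H3 U G) (hC : IsInsertionBound U C) {a : List ℤ} {N : ℕ} (ha : IsMinimalRec U a N)
    (h0 : coeffGcd a ≠ 0) {A c : DFACode} (hc : c.language = repLang U Set.univ) {d : ℕ}
    (hd : IsThreshold U a (constZ U G C) (boundQ U a.length N A) d)
    (hX : UltimatelyPeriodic (recognizedSet U A)) :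
    period (recognizedSet U A) ≤ boundPeriod U a.length N (a.getD 0 0).natAbs A c d := by
  have hQ := QX_le_boundQ hU h2 h3 hC ha h0 hX
  refine (le_coprimePart_mul_pow hX.hasEventualPeriod.1.ne' ha.1.2.1).trans ?_
  refine Nat.mul_le_mul hQ (Nat.pow_le_pow_right (Int.natAbs_pos.2 ha.1.2.1) ?_)
  by_cases hlt : maxExponent a (period (recognizedSet U A)) < d
  · omega
  refine le_trans ?_ (Nat.le_add_left _ _)
  have hle := not_lt.1 hlt
  have hpos := lt_of_lt_of_le hd.1 hle
  have hlen := rep_rhoX_length_lt hU h2 h3 hC ha.1 hc hX hpos (hd.2 _ hX hQ hle)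
    (Nat.factorial_pos _) (ha.1.modEq_factorial (QX_pos a _) hQ)
  have hlen' : (rep U (rhoX a (recognizedSet U A) - 1)).length ≤ boundLength U a.length N A c :=
    hlen.le.trans (Nat.add_le_add_left (Nat.mul_le_mul_left _ (Nat.mul_le_mul_left _ hQ)) _)
  have hρ := lt_of_lt_of_le (hU.lt_rep_length (rhoX a (recognizedSet U A) - 1))
    (hU.strictMono.monotone hlen')
  obtain ⟨hr, -, hmax⟩ := hX.rX_spec hpos
  have hρ0 : 0 < rhoX a (recognizedSet U A) :=
    (UltimatelyPeriodic.hasEventualPeriod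
      ⟨_, hX.hasEventualPeriod.residuePart (hX.QX_dvd a) hr⟩).1
  -- By the choice of `r_X`, ρ_X has the same maximal exponent as π, and an exponent in ρ_X is
  -- smaller than ρ_X.
  rw [← hmax]
  refine Finset.sup_le fun p _ => ?_
  have := Nat.factorization_lt p hρ0.ne'
  omega


/-! ### A bounded test for a given eventual period -/

section Pump

variable {U : ℕ → ℕ} {A c : DFACode} {p P pre : ℕ}

theorem exists_pump_rep (hU : IsNumerationSystem U) (hp : 0 < p) (hP : 0 < P) {n : ℕ}
    (hn : U (pre + P * ((A.last + 2) * (c.last + 2) * p)) ≤ n) :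
    ∃ x y z : List ℕ, rep U n = x ++ y ++ z ∧ 0 < y.length ∧ P ∣ y.length ∧
      y.length ≤ P * ((A.last + 2) * (c.last + 2) * p) ∧ pre ≤ z.length ∧
      (A.run (x ++ y) = A.run x ∧ c.run (x ++ y) = c.run x) ∧
      val U (y ++ z) ≡ val U z [MOD p] := by
  have h := exists_pump U hp hP (fun w => (A.run w, c.run w))
    (Finset.range (A.last + 2) ×ˢ Finset.range (c.last + 2))
    (fun w => by simp only [Finset.mem_product, DFACode.run_mem, and_self]) (rep U n) (by
      simpa using (hU.lt_rep_length_of_le hn).le)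
  simpa using h

theorem mem_recognizedSet_iff_of_run_eq (hU : IsNumerationSystem U)
    (hc : c.language = repLang U Set.univ) {n : ℕ} {w : List ℕ} (hA : A.run w = A.run (rep U n))
    (hcw : c.run w = c.run (rep U n)) :
    rep U (val U w) = w ∧ (val U w ∈ recognizedSet U A ↔ n ∈ recognizedSet U A) := by
  have hw : w ∈ repLang U Set.univ := by
    rw [← hc]
    refine (c.mem_language_congr hcw).2 ?_
    rw [hc]
    exact ⟨n, trivial, rfl⟩
  refine ⟨hU.rep_val hw, ?_⟩
  rw [hU.val_mem_recognizedSet A hw]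
  exact A.mem_language_congr hA

theorem exists_gt_modEq (hU : IsNumerationSystem U) (hc : c.language = repLang U Set.univ)
    (hp : 0 < p) (hP : 0 < P) (hper : ∀ i ≥ pre, U (i + P) ≡ U i [MOD p]) {n : ℕ}
    (hn : U (pre + P * ((A.last + 2) * (c.last + 2) * p)) ≤ n) :
    ∃ n' > n, n' ≡ n [MOD p] ∧ (n' ∈ recognizedSet U A ↔ n ∈ recognizedSet U A) := by
  obtain ⟨x, y, z, hw, hy, hPy, -, hz, ⟨hA, hcr⟩, hyz⟩ := exists_pump_rep (A := A) (c := c) hU hp hP hn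
  have e1 : x ++ y ++ y ++ z = x ++ y ++ (y ++ z) := by simp
  have e2 : x ++ y ++ z = x ++ (y ++ z) := by simp
  obtain ⟨h1, h2⟩ := mem_recognizedSet_iff_of_run_eq (A := A) hU hc (n := n)
    (w := x ++ y ++ y ++ z) (by rw [hw, e1, e2]; exact A.run_append_congr hA _)
    (by rw [hw, e1, e2]; exact c.run_append_congr hcr _)
  refine ⟨_, ?_, ?_, h2⟩
  · refine lt_of_lt_of_le (hU.lt_rep_length n) (le_of_lt_rep_length ?_)
    rw [h1, hw]
    simp only [List.length_append]
    omega
  · have h3 := val_pump_up hper (a := x) hPy hz hyz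
    rwa [← hw, (hU.rep_spec n).1] at h3

/-- The removed factor has length at most `T`, so a representation longer than `2 * T` stays longer
than `T` and the result does not fall below `U T`. -/
theorem exists_lt_modEq (hU : IsNumerationSystem U) (hc : c.language = repLang U Set.univ)
    (hp : 0 < p) (hP : 0 < P) (hper : ∀ i ≥ pre, U (i + P) ≡ U i [MOD p]) {n T : ℕ}
    (hT : pre + P * ((A.last + 2) * (c.last + 2) * p) ≤ T) (hn : U (2 * T) ≤ n) :
    ∃ n' < n, U T ≤ n' ∧ n' ≡ n [MOD p] ∧ (n' ∈ recognizedSet U A ↔ n ∈ recognizedSet U A) := by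
  obtain ⟨x, y, z, hw, hy, hPy, hyl, hz, ⟨hA, hcr⟩, hyz⟩ := exists_pump_rep (A := A) (c := c) hU hp hP
    ((hU.strictMono.monotone (show pre + P * ((A.last + 2) * (c.last + 2) * p) ≤ 2 * T by omega)).trans hn)
  obtain ⟨h1, h2⟩ := mem_recognizedSet_iff_of_run_eq (A := A) hU hc (n := n) (w := x ++ z)
    (by rw [hw]; exact (A.run_append_congr hA z).symm)
    (by rw [hw]; exact (c.run_append_congr hcr z).symm)
  have hlen := hU.lt_rep_length_of_le hn
  have hlt := hU.lt_rep_length (val U (x ++ z))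
  have hwl := congrArg List.length hw
  simp only [List.length_append] at hwl
  refine ⟨_, ?_, ?_, ?_, h2⟩
  · refine lt_of_lt_of_le hlt (le_of_lt_rep_length ?_)
    rw [h1, hwl, List.length_append]
    omega
  · refine le_of_lt_rep_length ?_
    rw [h1, List.length_append]
    omega
  · have h3 := val_pump_down hper (a := x) hPy hz hyz
    rw [← hw, (hU.rep_spec n).1] at h3
    exact h3.symm

/-- If p is an eventual period, two congruent numbers of the window are pumped up past the unknown
preperiod and compared there. Conversely, every number from `U T` on is pumped down into the window.
-/
theorem hasEventualPeriod_iff_bounded (hU : IsNumerationSystem U)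
    (hc : c.language = repLang U Set.univ) (hp : 0 < p) (hP : 0 < P)
    (hper : ∀ i ≥ pre, U (i + P) ≡ U i [MOD p]) {T : ℕ}
    (hT : pre + P * ((A.last + 2) * (c.last + 2) * p) ≤ T) :
    HasEventualPeriod (recognizedSet U A) p ↔ ∀ m < U (2 * T), ∀ n < U (2 * T), U T ≤ m → U T ≤ n →
      m % p = n % p → (m ∈ recognizedSet U A ↔ n ∈ recognizedSet U A) := by
  have hUT := hU.strictMono.monotone hT
  constructor
  · rintro ⟨-, s, hs⟩ m - n - hm hn hmn
    have up : ∀ n, U T ≤ n → ∀ t, ∃ n' ≥ n + t, n' ≡ n [MOD p] ∧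
        (n' ∈ recognizedSet U A ↔ n ∈ recognizedSet U A) := by
      intro n hn t
      induction t with
      | zero => exact ⟨n, le_rfl, rfl, Iff.rfl⟩
      | succ t ih =>
        obtain ⟨n', h1, h2, h3⟩ := ih
        obtain ⟨n'', h4, h5, h6⟩ := exists_gt_modEq (A := A) hU hc hp hP hper (n := n') (by omega)
        exact ⟨n'', by omega, h5.trans h2, h6.trans h3⟩
    obtain ⟨m', hm1, hm2, hm3⟩ := up m hm s
    obtain ⟨n', hn1, hn2, hn3⟩ := up n hn s
    rw [← hm3, ← hn3]
    exact mem_iff_of_modEq hs (by omega) (by omega) ((hm2.trans hmn).trans hn2.symm)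
  · intro h
    have down : ∀ n, U T ≤ n → ∃ n' < U (2 * T), U T ≤ n' ∧ n' ≡ n [MOD p] ∧
        (n' ∈ recognizedSet U A ↔ n ∈ recognizedSet U A) := by
      intro n
      induction n using Nat.strong_induction_on with
      | _ n ih =>
        intro hn
        by_cases hlt : n < U (2 * T)
        · exact ⟨n, hlt, hn, rfl, Iff.rfl⟩
        · obtain ⟨m, h1, h2, h3, h4⟩ := exists_lt_modEq (A := A) hU hc hp hP hper hT (not_lt.1 hlt)
          obtain ⟨n', h5, h6, h7, h8⟩ := ih m h1 h2
          exact ⟨n', h5, h6, h7.trans h3, h8.trans h4⟩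
    refine ⟨hp, U T, fun n hn => ?_⟩
    obtain ⟨m, hm1, hm2, hm3, hm4⟩ := down n hn
    obtain ⟨m', hn1, hn2, hn3, hn4⟩ := down (n + p) (by omega)
    rw [← hm4, ← hn4]
    refine h m hm1 m' hn1 hm2 hn2 (hm3.trans (Nat.ModEq.trans ?_ hn3.symm))
    simp [Nat.ModEq]

end Pump

/-- A length from which on pumping is possible for all periods up to `W`. -/
def testLength (k N : ℕ) (A c : DFACode) (W : ℕ) : ℕ :=
  N + W ^ k + (W ^ k).factorial * ((A.last + 2) * (c.last + 2) * W)

theorem ultimatelyPeriodic_iff_bounded {U : ℕ → ℕ} (hU : IsNumerationSystem U) {G C : ℕ}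
    (h2 : H2 U) (h3 : H3 U G) (hC : IsInsertionBound U C) {a : List ℤ} {N : ℕ}
    (ha : IsMinimalRec U a N) (h0 : coeffGcd a ≠ 0) {A c : DFACode}
    (hc : c.language = repLang U Set.univ) {d : ℕ}
    (hd : IsThreshold U a (constZ U G C) (boundQ U a.length N A) d) {W T : ℕ}
    (hW : W = boundPeriod U a.length N (a.getD 0 0).natAbs A c d)
    (hT : T = testLength a.length N A c W) :
    UltimatelyPeriodic (recognizedSet U A) ↔ ∃ p < W + 1, 0 < p ∧
      ∀ m < U (2 * T), ∀ n < U (2 * T), U T ≤ m → U T ≤ n → m % p = n % p →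
        (m ∈ recognizedSet U A ↔ n ∈ recognizedSet U A) := by
  have key : ∀ p < W + 1, 0 < p → (HasEventualPeriod (recognizedSet U A) p ↔
      ∀ m < U (2 * T), ∀ n < U (2 * T), U T ≤ m → U T ≤ n → m % p = n % p →
        (m ∈ recognizedSet U A ↔ n ∈ recognizedSet U A)) := by
    intro p hpW hp
    refine hasEventualPeriod_iff_bounded hU hc hp (Nat.factorial_pos _)
      (ha.1.modEq_factorial hp (Nat.le_of_lt_succ hpW)) ?_
    rw [hT]
    exact Nat.add_le_add_left (Nat.mul_le_mul_left _ (Nat.mul_le_mul_left _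
      (Nat.le_of_lt_succ hpW))) _
  constructor
  · intro hX
    have hle := period_le_boundPeriod hU h2 h3 hC ha h0 hc hd hX
    rw [← hW] at hle
    have hper := hX.hasEventualPeriod
    exact ⟨_, Nat.lt_succ_of_le hle, hper.1, (key _ (Nat.lt_succ_of_le hle) hper.1).1 hper⟩
  · rintro ⟨p, hpW, hp, h⟩
    exact ⟨p, (key p hpW hp).2 h⟩

/-! ### Membership without representations -/

/-- The state reached by reading the greedy digits of `n` at the positions `l - 1, …, 0`. -/
def greedyRun (U : ℕ → ℕ) (A : DFACode) (l n : ℕ) : ℕ :=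
  ((List.range l).reverse.foldl (fun s i => (s.1 % U i, A.stepNat s.2 (s.1 / U i)))
    (n, A.start % (A.last + 1))).2

theorem greedyRun_eq (U : ℕ → ℕ) (A : DFACode) (l n : ℕ) :
    greedyRun U A l n = A.run (greedyDigits U l n) := by
  rw [greedyRun, DFACode.run]
  generalize A.start % (A.last + 1) = q
  induction l generalizing n q with
  | zero => rfl
  | succ l ih =>
    rw [List.range_succ, List.reverse_append, List.reverse_singleton, List.singleton_append,
      List.foldl_cons, ih, greedyDigits, List.foldl_cons]

/-- Membership of `n < U L` in the recognized set. -/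
def Recognizes (U : ℕ → ℕ) (A : DFACode) (L n : ℕ) : Prop :=
  ∃ l < L, U l ≤ n ∧ n < U (l + 1) ∧ A.AcceptsState (greedyRun U A (l + 1) n)

/-- The length of the representation is found by bounded search. Zero is excluded because its
representation is empty, whereas `Recognizes` reads at least one digit. -/
theorem recognizes_iff {U : ℕ → ℕ} (hU : IsNumerationSystem U) (A : DFACode) {L n : ℕ}
    (hn : 0 < n) (hL : n < U L) : Recognizes U A L n ↔ n ∈ recognizedSet U A := by
  have key : ∀ l, U l ≤ n → n < U (l + 1) →
      (A.AcceptsState (greedyRun U A (l + 1) n) ↔ n ∈ recognizedSet U A) := by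
    intro l h1 h2
    rw [greedyRun_eq, ← hU.rep_eq_greedyDigits h1 h2, ← A.mem_language_iff]
    rfl
  constructor
  · rintro ⟨l, -, h1, h2, h3⟩
    exact (key l h1 h2).1 h3
  · intro h
    have h1 := hU.lt_rep_length_of_le (l := 0) (n := n) (by rw [hU.zero]; exact hn)
    have h2 : U ((rep U n).length - 1) ≤ n := le_of_lt_rep_length (by omega)
    have h3 : n < U ((rep U n).length - 1 + 1) := by
      rw [Nat.sub_add_cancel h1]
      exact hU.lt_rep_length n
    refine ⟨(rep U n).length - 1, ?_, h2, h3, (key _ h2 h3).2 h⟩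
    have := rep_length_le hL
    omega


/-! ### Computing the terms of a coded numeration system -/

namespace SystemCode

/-- The term determined by the recurrence relation and the list of all earlier terms. -/
def nextTerm (S : SystemCode) (t : List ℕ) : ℕ :=
  (∑ j ∈ Finset.range S.coeffs.length,
    (S.coeffs.getD j 0).toNat * t.getD (t.length - S.coeffs.length + j) 0) -
  ∑ j ∈ Finset.range S.coeffs.length,
    ((S.coeffs.getD j 0).natAbs - (S.coeffs.getD j 0).toNat) *
      t.getD (t.length - S.coeffs.length + j) 0

/-- The first `S.init.length + n` terms. -/
def terms (S : SystemCode) (n : ℕ) : List ℕ :=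
  Nat.rec S.init (fun _ t => t ++ [S.nextTerm t]) n

/-- The list has `S.init.length + i` entries, so the default is never used once `init` is nonempty.
-/
def term (S : SystemCode) (i : ℕ) : ℕ := (S.terms i).getD i 0

theorem terms_length (S : SystemCode) (n : ℕ) : (S.terms n).length = S.init.length + n := by
  induction n with
  | zero => rfl
  | succ n ih =>
    change (S.terms n ++ [S.nextTerm (S.terms n)]).length = _
    rw [List.length_append, ih, List.length_singleton, Nat.add_assoc]

theorem Describes.getD_terms {S : SystemCode} {U : ℕ → ℕ} (h : S.Describes U) (n : ℕ) :
    ∀ i < S.init.length + n, (S.terms n).getD i 0 = U i := by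
  induction n with
  | zero => exact fun i hi => (h.init_eq i hi).symm
  | succ n ih =>
    intro i hi
    change (S.terms n ++ [S.nextTerm (S.terms n)]).getD i 0 = U i
    have hlen := S.terms_length n
    have hle := h.length_le
    by_cases hin : i < S.init.length + n
    · rw [List.getD_append _ _ _ _ (by omega)]
      exact ih i hin
    obtain rfl : i = S.init.length + n := by omega
    rw [List.getD_append_right _ _ _ _ (by omega), hlen, Nat.sub_self, List.getD_cons_zero,
      nextTerm, hlen]
    have hterm : ∀ j ∈ Finset.range S.coeffs.length,
        (S.terms n).getD (S.init.length + n - S.coeffs.length + j) 0 =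
          U (S.init.length + n - S.coeffs.length + j) := by
      intro j hj
      rw [Finset.mem_range] at hj
      exact ih _ (by omega)
    have hsum : ∀ c : ℕ → ℕ, (∑ j ∈ Finset.range S.coeffs.length,
        c j * (S.terms n).getD (S.init.length + n - S.coeffs.length + j) 0) =
        ∑ j ∈ Finset.range S.coeffs.length, c j * U (S.init.length + n - S.coeffs.length + j) :=
      fun c => Finset.sum_congr rfl fun j hj => by rw [hterm j hj]
    rw [hsum fun j => (S.coeffs.getD j 0).toNat,
      hsum fun j => (S.coeffs.getD j 0).natAbs - (S.coeffs.getD j 0).toNat]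
    have hrec := h.minimalRec.1.2.2 (S.init.length + n - S.coeffs.length) (by omega)
    rw [Nat.sub_add_cancel (by omega)] at hrec
    -- The truncated subtraction is exact: the positive part of the recurrence equals the new term
    -- plus the negative part.
    refine Nat.sub_eq_of_eq_add ?_
    zify
    rw [hrec, ← Finset.sum_add_distrib]
    refine Finset.sum_congr rfl fun j _ => ?_
    rw [← add_mul]
    congr 1
    omega

theorem Describes.term_eq {S : SystemCode} {U : ℕ → ℕ} (h : S.Describes U) : S.term = U := by
  funext i
  refine h.getD_terms i i ?_
  have := h.length_le
  have := h.minimalRec.1.length_pos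
  omega

end SystemCode

/-! ### Primitive recursiveness -/

section Primrec

variable {α : Type*} [Primcodable α]

/-- Integers are encoded by `n ↦ 2n` and `-(n+1) ↦ 2n+1`. -/
theorem primrec_int_natAbs : Primrec Int.natAbs := by
  refine (Primrec.nat_div.comp (Primrec.succ.comp Primrec.encode) (Primrec.const 2)).of_eq ?_
  intro z
  cases z with
  | ofNat n =>
    change (2 * n + 1) / 2 = n
    omega
  | negSucc n =>
    change (2 * n + 1 + 1) / 2 = n + 1
    omega

theorem primrec_int_toNat : Primrec Int.toNat := by
  refine (Primrec.ite (c := fun z : ℤ => Encodable.encode z % 2 = 0)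
    (Primrec.eq.comp (Primrec.nat_mod.comp Primrec.encode (Primrec.const 2)) (Primrec.const 0))
    (Primrec.nat_div.comp Primrec.encode (Primrec.const 2)) (Primrec.const 0)).of_eq ?_
  intro z
  cases z with
  | ofNat n =>
    change (if 2 * n % 2 = 0 then 2 * n / 2 else 0) = n
    simp
  | negSucc n =>
    change (if (2 * n + 1) % 2 = 0 then (2 * n + 1) / 2 else 0) = 0
    rw [if_neg (by omega)]

theorem Primrec.sum_range {f : α → ℕ} {g : α → ℕ → ℕ} (hf : Primrec f) (hg : Primrec₂ g) :
    Primrec fun a => ∑ j ∈ Finset.range (f a), g a j := by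
  refine (Primrec.nat_rec' hf (Primrec.const 0) (h := fun a s => s.2 + g a s.1)
    (Primrec.nat_add.comp (Primrec.snd.comp Primrec.snd)
      (hg.comp Primrec.fst (Primrec.fst.comp Primrec.snd)))).of_eq fun a => ?_
  induction f a with
  | zero => rfl
  | succ n ih => rw [Finset.sum_range_succ, ← ih]

theorem primrec_factorial : Primrec Nat.factorial := by
  refine (Primrec.nat_rec₁ 1 (f := fun n s => (n + 1) * s)
    (Primrec.nat_mul.comp (Primrec.succ.comp Primrec.fst) Primrec.snd)).of_eq fun n => ?_
  induction n with
  | zero => rfl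
  | succ n ih => rw [Nat.factorial_succ, ← ih]

theorem primrec_pow : Primrec₂ fun m n : ℕ => m ^ n := by
  refine Primrec₂.unpaired'.1 ?_
  exact Nat.Primrec.pow

namespace DFACode

theorem primrec_equivTuple : Primrec equivTuple := Primrec.of_equiv

theorem primrec_letters : Primrec letters :=
  (Primrec.fst.comp primrec_equivTuple).of_eq fun _ => rfl

theorem primrec_last : Primrec last :=
  ((Primrec.fst.comp Primrec.snd).comp primrec_equivTuple).of_eq fun _ => rfl

theorem primrec_start : Primrec start :=
  ((Primrec.fst.comp (Primrec.snd.comp Primrec.snd)).comp primrec_equivTuple).of_eq fun _ => rfl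

theorem primrec_accept : Primrec accept :=
  ((Primrec.fst.comp (Primrec.snd.comp (Primrec.snd.comp Primrec.snd))).comp primrec_equivTuple).of_eq fun _ => rfl

theorem primrec_table : Primrec table :=
  ((Primrec.snd.comp (Primrec.snd.comp (Primrec.snd.comp Primrec.snd))).comp primrec_equivTuple).of_eq fun _ => rfl

theorem primrec_stepNat {c : α → DFACode} {q x : α → ℕ} (hc : Primrec c) (hq : Primrec q)
    (hx : Primrec x) : Primrec fun a => (c a).stepNat (q a) (x a) := by
  have hlast := Primrec.succ.comp (primrec_last.comp hc)
  refine Primrec.ite (PrimrecPred.and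
    (Primrec.nat_lt.comp hx (primrec_letters.comp hc))
    (Primrec.nat_le.comp hq (primrec_last.comp hc))) ?_ hlast
  exact Primrec.nat_mod.comp ((Primrec.list_getD 0).comp
    ((Primrec.list_getD []).comp (primrec_table.comp hc) hq) hx) hlast

theorem primrecPred_acceptsState {c : α → DFACode} {q : α → ℕ} (hc : Primrec c)
    (hq : Primrec q) : PrimrecPred fun a => (c a).AcceptsState (q a) := by
  refine PrimrecPred.and (Primrec.nat_le.comp hq (primrec_last.comp hc)) ?_
  have h : PrimrecRel fun (l : List ℕ) (n : ℕ) => n ∈ l :=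
    (PrimrecRel.exists_mem_list (R := fun m n : ℕ => m = n) Primrec.eq).of_eq (by simp)
  exact h.comp (primrec_accept.comp hc) hq

end DFACode

namespace SystemCode

theorem primrec_equivTuple : Primrec equivTuple := Primrec.of_equiv

theorem primrec_coeffs : Primrec coeffs :=
  (Primrec.fst.comp primrec_equivTuple).of_eq fun _ => rfl

theorem primrec_init : Primrec init :=
  ((Primrec.fst.comp Primrec.snd).comp primrec_equivTuple).of_eq fun _ => rfl

theorem primrec_automaton : Primrec automaton :=
  ((Primrec.snd.comp (Primrec.snd.comp Primrec.snd)).comp primrec_equivTuple).of_eq fun _ => rfl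

theorem primrec_nextTerm : Primrec₂ nextTerm := by
  have hk : Primrec fun x : SystemCode × List ℕ => x.1.coeffs.length :=
    Primrec.list_length.comp (primrec_coeffs.comp Primrec.fst)
  have hcoeff : Primrec fun y : (SystemCode × List ℕ) × ℕ => y.1.1.coeffs.getD y.2 0 :=
    (Primrec.list_getD 0).comp (primrec_coeffs.comp (Primrec.fst.comp Primrec.fst)) Primrec.snd
  have hpos := primrec_int_toNat.comp hcoeff
  have habs := primrec_int_natAbs.comp hcoeff
  have hterm : Primrec fun y : (SystemCode × List ℕ) × ℕ =>
      y.1.2.getD (y.1.2.length - y.1.1.coeffs.length + y.2) 0 :=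
    (Primrec.list_getD 0).comp (Primrec.snd.comp Primrec.fst)
      (Primrec.nat_add.comp (Primrec.nat_sub.comp
        (Primrec.list_length.comp (Primrec.snd.comp Primrec.fst)) (hk.comp Primrec.fst))
        Primrec.snd)
  exact Primrec.nat_sub.comp
    (Primrec.sum_range hk (Primrec.nat_mul.comp hpos hterm).to₂)
    (Primrec.sum_range hk (Primrec.nat_mul.comp (Primrec.nat_sub.comp habs hpos) hterm).to₂)

theorem primrec_terms : Primrec₂ terms := by
  have h : Primrec₂ fun (S : SystemCode) (s : ℕ × List ℕ) => s.2 ++ [S.nextTerm s.2] :=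
    Primrec.list_concat.comp (Primrec.snd.comp Primrec.snd)
      (primrec_nextTerm.comp Primrec.fst (Primrec.snd.comp Primrec.snd))
  exact Primrec.nat_rec primrec_init h

theorem primrec_term {S : α → SystemCode} {i : α → ℕ} (hS : Primrec S) (hi : Primrec i) :
    Primrec fun a => (S a).term (i a) :=
  (Primrec.list_getD 0).comp (primrec_terms.comp hS hi) hi

/-- The number of terms before the recurrence relation holds. -/
def shift (S : SystemCode) : ℕ := S.init.length - S.coeffs.length

theorem primrec_shift : Primrec shift :=
  Primrec.nat_sub.comp (Primrec.list_length.comp primrec_init)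
    (Primrec.list_length.comp primrec_coeffs)

end SystemCode

section

variable {S : α → SystemCode} {A : α → DFACode}

theorem primrec_greedyRun {l n : α → ℕ} (hS : Primrec S) (hA : Primrec A) (hl : Primrec l)
    (hn : Primrec n) : Primrec fun a => greedyRun (S a).term (A a) (l a) (n a) := by
  have hU : Primrec fun y : α × (ℕ × ℕ) × ℕ => (S y.1).term y.2.2 :=
    SystemCode.primrec_term (hS.comp Primrec.fst) (Primrec.snd.comp Primrec.snd)
  have h1 : Primrec fun y : α × (ℕ × ℕ) × ℕ => y.2.1.1 :=
    Primrec.fst.comp (Primrec.fst.comp Primrec.snd)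
  refine Primrec.snd.comp (Primrec.list_foldl
    (h := fun a y => (y.1.1 % (S a).term y.2, (A a).stepNat y.1.2 (y.1.1 / (S a).term y.2)))
    (Primrec.list_reverse.comp (Primrec.list_range.comp hl))
    (Primrec.pair hn (Primrec.nat_mod.comp (DFACode.primrec_start.comp hA)
      (Primrec.succ.comp (DFACode.primrec_last.comp hA)))) ?_)
  exact Primrec.pair (Primrec.nat_mod.comp h1 hU)
    (DFACode.primrec_stepNat (hA.comp Primrec.fst)
      (Primrec.snd.comp (Primrec.fst.comp Primrec.snd)) (Primrec.nat_div.comp h1 hU))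

theorem PrimrecPred.exists_lt_of {β : Type*} [Primcodable β] {f : β → ℕ} {p : ℕ → β → Prop}
    (hf : Primrec f) (hp : PrimrecPred fun y : ℕ × β => p y.1 y.2) :
    PrimrecPred fun b => ∃ n < f b, p n b :=
  ((PrimrecRel.exists_mem_list (R := p) hp).comp (Primrec.list_range.comp hf) Primrec.id).of_eq
    fun b => by simp

theorem PrimrecPred.forall_lt_of {β : Type*} [Primcodable β] {f : β → ℕ} {p : ℕ → β → Prop}
    (hf : Primrec f) (hp : PrimrecPred fun y : ℕ × β => p y.1 y.2) :
    PrimrecPred fun b => ∀ n < f b, p n b :=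
  ((PrimrecRel.forall_mem_list (R := p) hp).comp (Primrec.list_range.comp hf) Primrec.id).of_eq
    fun b => by simp

theorem PrimrecPred.imp {p q : α → Prop} (hp : PrimrecPred p) (hq : PrimrecPred q) :
    PrimrecPred fun a => p a → q a :=
  (hp.not.or hq).of_eq fun _ => imp_iff_not_or.symm

theorem PrimrecPred.iff {p q : α → Prop} (hp : PrimrecPred p) (hq : PrimrecPred q) :
    PrimrecPred fun a => p a ↔ q a :=
  ((hp.imp hq).and (hq.imp hp)).of_eq fun _ => iff_def.symm

theorem primrecPred_recognizes {L n : α → ℕ} (hS : Primrec S) (hA : Primrec A) (hL : Primrec L)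
    (hn : Primrec n) : PrimrecPred fun a => Recognizes (S a).term (A a) (L a) (n a) := by
  have hS' : Primrec fun y : ℕ × α => S y.2 := hS.comp Primrec.snd
  have hA' : Primrec fun y : ℕ × α => A y.2 := hA.comp Primrec.snd
  have hn' : Primrec fun y : ℕ × α => n y.2 := hn.comp Primrec.snd
  have hs : Primrec fun y : ℕ × α => y.1 + 1 := Primrec.succ.comp Primrec.fst
  refine PrimrecPred.exists_lt_of hL ?_
  exact (Primrec.nat_le.comp (SystemCode.primrec_term hS' Primrec.fst) hn').and
    ((Primrec.nat_lt.comp hn' (SystemCode.primrec_term hS' hs)).and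
      (DFACode.primrecPred_acceptsState hA' (primrec_greedyRun hS' hA' hs hn')))

theorem primrec_boundQ : Primrec fun x : SystemCode × DFACode =>
    boundQ x.1.term x.1.coeffs.length x.1.shift x.2 := by
  have hk : Primrec fun x : SystemCode × DFACode => x.1.coeffs.length :=
    Primrec.list_length.comp (SystemCode.primrec_coeffs.comp Primrec.fst)
  have hN : Primrec fun x : SystemCode × DFACode => x.1.shift :=
    SystemCode.primrec_shift.comp Primrec.fst
  have hU := SystemCode.primrec_term (S := fun x : SystemCode × DFACode => x.1) Primrec.fst
    (Primrec.nat_add.comp hN (Primrec.nat_mul.comp (Primrec.const 2) hk))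
  exact Primrec.nat_mul.comp
    (primrec_factorial.comp (Primrec.nat_add.comp (DFACode.primrec_last.comp Primrec.snd)
      (Primrec.const 2)))
    (Primrec.nat_mul.comp (primrec_factorial.comp hk) (primrec_pow.comp hU hk))

end

end Primrec


/-- The bounded test for ultimate periodicity of the set recognized by `A`, with `d` a threshold
for the exponents. -/
def PeriodicityTest (S : SystemCode) (A : DFACode) (W T : ℕ) : Prop :=
  ∃ p < W + 1, 0 < p ∧ ∀ m < S.term (2 * T), ∀ n < S.term (2 * T),
    S.term T ≤ m → S.term T ≤ n → m % p = n % p →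
      (Recognizes S.term A (2 * T) m ↔ Recognizes S.term A (2 * T) n)

section

variable {α : Type*} [Primcodable α] {S : α → SystemCode} {A : α → DFACode}

theorem primrecPred_periodicityTest {W T : α → ℕ} (hS : Primrec S) (hA : Primrec A)
    (hW : Primrec W) (hT : Primrec T) :
    PrimrecPred fun a => PeriodicityTest (S a) (A a) (W a) (T a) := by
  have h2T : Primrec fun a => 2 * T a := Primrec.nat_mul.comp (Primrec.const 2) hT
  have hU2 : Primrec fun a => (S a).term (2 * T a) := SystemCode.primrec_term hS h2T
  have hU1 : Primrec fun a => (S a).term (T a) := SystemCode.primrec_term hS hT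
  -- Tuples are ordered `(n, m, p, a)`, the innermost quantifier first.
  have ha : Primrec fun y : ℕ × ℕ × ℕ × α => y.2.2.2 :=
    Primrec.snd.comp (Primrec.snd.comp Primrec.snd)
  have hp : Primrec fun y : ℕ × ℕ × ℕ × α => y.2.2.1 :=
    Primrec.fst.comp (Primrec.snd.comp Primrec.snd)
  have hm : Primrec fun y : ℕ × ℕ × ℕ × α => y.2.1 := Primrec.fst.comp Primrec.snd
  have hn : Primrec fun y : ℕ × ℕ × ℕ × α => y.1 := Primrec.fst
  have hrec : ∀ {f : ℕ × ℕ × ℕ × α → ℕ}, Primrec f → PrimrecPred fun y =>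
      Recognizes (S y.2.2.2).term (A y.2.2.2) (2 * T y.2.2.2) (f y) := fun hf =>
    primrecPred_recognizes (hS.comp ha) (hA.comp ha) (h2T.comp ha) hf
  have hle : ∀ {f : ℕ × ℕ × ℕ × α → ℕ}, Primrec f → PrimrecPred fun y =>
      (S y.2.2.2).term (T y.2.2.2) ≤ f y := fun hf => Primrec.nat_le.comp (hU1.comp ha) hf
  have hbody : PrimrecPred fun y : ℕ × ℕ × ℕ × α =>
      (S y.2.2.2).term (T y.2.2.2) ≤ y.2.1 → (S y.2.2.2).term (T y.2.2.2) ≤ y.1 →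
        y.2.1 % y.2.2.1 = y.1 % y.2.2.1 →
          (Recognizes (S y.2.2.2).term (A y.2.2.2) (2 * T y.2.2.2) y.2.1 ↔
            Recognizes (S y.2.2.2).term (A y.2.2.2) (2 * T y.2.2.2) y.1) :=
    (hle hm).imp ((hle hn).imp ((Primrec.eq.comp (Primrec.nat_mod.comp hm hp)
      (Primrec.nat_mod.comp hn hp)).imp ((hrec hm).iff (hrec hn))))
  refine PrimrecPred.exists_lt_of (Primrec.succ.comp hW)
    ((Primrec.nat_lt.comp (Primrec.const 0) Primrec.fst).and ?_)
  refine PrimrecPred.forall_lt_of (β := ℕ × α) (f := fun y => (S y.2).term (2 * T y.2))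
    (hU2.comp Primrec.snd) ?_
  exact PrimrecPred.forall_lt_of (β := ℕ × ℕ × α) (f := fun y => (S y.2.2).term (2 * T y.2.2))
    (hU2.comp (Primrec.snd.comp Primrec.snd)) hbody

end

namespace SystemCode

/-- The bound for the period of the set recognized by `A`, from a threshold `d`. -/
def boundW (S : SystemCode) (A : DFACode) (d : ℕ) : ℕ :=
  boundPeriod S.term S.coeffs.length S.shift (S.coeffs.getD 0 0).natAbs A S.automaton d

def boundT (S : SystemCode) (A : DFACode) (d : ℕ) : ℕ :=
  testLength S.coeffs.length S.shift A S.automaton (S.boundW A d)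

theorem primrec_boundW :
    Primrec fun x : (SystemCode × DFACode) × ℕ => x.1.1.boundW x.1.2 x.2 := by
  have hS : Primrec fun x : (SystemCode × DFACode) × ℕ => x.1.1 := Primrec.fst.comp Primrec.fst
  have hA : Primrec fun x : (SystemCode × DFACode) × ℕ => x.1.2 := Primrec.snd.comp Primrec.fst
  have hk := Primrec.list_length.comp (primrec_coeffs.comp hS)
  have hN := primrec_shift.comp hS
  have hB := primrec_boundQ.comp (Primrec.fst (α := SystemCode × DFACode) (β := ℕ))
  have hBk := primrec_pow.comp hB hk
  have hK := Primrec.nat_mul.comp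
    (Primrec.nat_add.comp (DFACode.primrec_last.comp hA) (Primrec.const 2))
    (Primrec.nat_add.comp (DFACode.primrec_last.comp (primrec_automaton.comp hS))
      (Primrec.const 2))
  have hlen := Primrec.nat_add.comp (Primrec.nat_add.comp hN hBk)
    (Primrec.nat_mul.comp (primrec_factorial.comp hBk)
      (Primrec.nat_mul.comp (Primrec.nat_mul.comp hK hK) hB))
  exact Primrec.nat_mul.comp hB (primrec_pow.comp
    (primrec_int_natAbs.comp ((Primrec.list_getD 0).comp (primrec_coeffs.comp hS)
      (Primrec.const 0)))
    (Primrec.nat_add.comp Primrec.snd (primrec_term hS hlen)))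

theorem primrec_boundT :
    Primrec fun x : (SystemCode × DFACode) × ℕ => x.1.1.boundT x.1.2 x.2 := by
  have hS : Primrec fun x : (SystemCode × DFACode) × ℕ => x.1.1 := Primrec.fst.comp Primrec.fst
  have hA : Primrec fun x : (SystemCode × DFACode) × ℕ => x.1.2 := Primrec.snd.comp Primrec.fst
  have hWk := primrec_pow.comp primrec_boundW (Primrec.list_length.comp (primrec_coeffs.comp hS))
  have hK := Primrec.nat_mul.comp
    (Primrec.nat_add.comp (DFACode.primrec_last.comp hA) (Primrec.const 2))
    (Primrec.nat_add.comp (DFACode.primrec_last.comp (primrec_automaton.comp hS))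
      (Primrec.const 2))
  exact Primrec.nat_add.comp (Primrec.nat_add.comp (primrec_shift.comp hS) hWk)
    (Primrec.nat_mul.comp (primrec_factorial.comp hWk) (Primrec.nat_mul.comp hK primrec_boundW))

theorem Describes.periodicityTest_iff {S : SystemCode} {U : ℕ → ℕ} (hS : S.Describes U)
    (hU : IsNumerationSystem U) {G C : ℕ} (h2 : H2 U) (h3 : H3 U G) (hC : IsInsertionBound U C)
    (h0 : coeffGcd S.coeffs ≠ 0) {A : DFACode} {d : ℕ}
    (hd : IsThreshold U S.coeffs (constZ U G C) (boundQ U S.coeffs.length S.shift A) d) :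
    PeriodicityTest S A (S.boundW A d) (S.boundT A d) ↔
      UltimatelyPeriodic (recognizedSet U A) := by
  have hterm := hS.term_eq
  rw [ultimatelyPeriodic_iff_bounded hU h2 h3 hC hS.minimalRec h0 hS.automaton_spec hd
    (W := S.boundW A d) (T := S.boundT A d) (by rw [boundW, hterm]; rfl) rfl, PeriodicityTest,
    hterm]
  have hrec : ∀ n, U (S.boundT A d) ≤ n → n < U (2 * S.boundT A d) →
      (Recognizes U A (2 * S.boundT A d) n ↔ n ∈ recognizedSet U A) := fun n h1 h2 =>
    recognizes_iff hU A ((hU.pos _).trans_le h1) h2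
  refine exists_congr fun p => and_congr_right fun _ => and_congr_right fun _ =>
    forall_congr' fun m => forall_congr' fun hm => forall_congr' fun n => forall_congr' fun hn =>
    forall_congr' fun hm' => forall_congr' fun hn' => forall_congr' fun _ => ?_
  rw [hrec m hm' hm, hrec n hn' hn]

end SystemCode

/-! ### The decision procedure -/

theorem mainTheorem2 (D : SystemCode × ℕ →. ℕ) (hD : Partrec D) :
    ∃ f : SystemCode × DFACode →. Bool, Partrec f ∧
      ∀ (S : SystemCode) (U : ℕ → ℕ) (C : ℕ),
        IsNumerationSystem U → S.Describes U →
        H1 U → H2 U → H3 U S.gapStart → 1 < coeffGcd S.coeffs →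
        IsInsertionBound U C →
        (∀ B : ℕ, 1 ≤ B → ∃ d ∈ D (S, B),
          IsThreshold U S.coeffs (constZ U S.gapStart C) B d) →
        ∀ A : DFACode, A.language ≤ repLang U Set.univ →
          ∃ answer ∈ f (S, A),
            (answer = true ↔ UltimatelyPeriodic (recognizedSet U A)) := by
  classical
  -- A single query to `D`, at the computable bound for Q_X, is the only partial step; Z and C enter
  -- only through the threshold property of its answer.
  refine ⟨fun x => (D (x.1, boundQ x.1.term x.1.coeffs.length x.1.shift x.2)).map fun d =>
    decide (PeriodicityTest x.1 x.2 (x.1.boundW x.2 d) (x.1.boundT x.2 d)), ?_, ?_⟩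
  · refine Partrec.map (hD.comp (Primrec.pair Primrec.fst primrec_boundQ).to_comp) ?_
    exact (primrecPred_periodicityTest (Primrec.fst.comp Primrec.fst)
      (Primrec.snd.comp Primrec.fst) SystemCode.primrec_boundW
      SystemCode.primrec_boundT).decide.to_comp.to₂
  · intro S U C hU hS _ h2 h3 hg hC hthr A _
    have hB : 1 ≤ boundQ U S.coeffs.length S.shift A :=
      Nat.mul_pos (Nat.factorial_pos _)
        (Nat.mul_pos (Nat.factorial_pos _) (pow_pos (hU.pos _) _))
    obtain ⟨d, hdD, hd⟩ := hthr _ hB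
    have hd' : d ∈ D (S, boundQ S.term S.coeffs.length S.shift A) := by
      rw [hS.term_eq]
      exact hdD
    refine ⟨_, Part.mem_map _ hd', ?_⟩
    rw [decide_eq_true_iff]
    exact hS.periodicityTest_iff hU h2 h3 hC (by omega) hd
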